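/- **Definitions.** A *parallelogram polyomino* is the set of cells between two lattice paths made of unit North and East steps, the *upper* and the *lower* path, which have the same starting point and the same end point and meet nowhere else. A *periodic parallelogram polyomino* (PPP) is a parallelogram polyomino together with a positive integer $g$ (the gluing size) that is at most the heights of its first (leftmost) and last (rightmost) columns; a rectangle whose gluing size equals the size of its columns is excluded. The bottom $g$ cells of the first column are glued to the top $g$ cells of the last column, so that the polyomino lies on a cylinder, and two rows glued together count as the same row. The *width* is the number of columns, the *height* is the number of rows (after gluing), and the *area* is the number of cells. The first $g$ steps of the upper path and the last $g$ steps of the lower path are the North steps along which the first and the last column are glued; "the upper path of a PPP" means the upper path without its first $g$ steps, and "the lower path of a PPP" means the lower path without its last $g$ steps. The map $\varphi(P)$ has a black vertex for each column (its top cell) and a white vertex for each row (its rightmost cell); the parent of a column vertex is the row vertex of the same row, and the parent of a row vertex is the column vertex of the same column. The children of a vertex are ordered by distance to it, the closest first. The map is rooted at the vertex of the first column. Recursively deleting the rows and columns that correspond to leaves (vertices without children) leaves the *trunk* of $P$, a PPP with upper path $N^k(NE)^l$, lower path $(EN)^lN^k$ (both written in full) and gluing size $k$, for some $k,l\ge 1$.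 The *intrinsic thickness* of $P$ is the gluing size $k$ of its trunk, and $l$ is the width of the trunk. The *cyclic structure* of $P$ is the graph $\varphi(\mathrm{trunk}(P))$, with edges directed from child to parent and with its column vertices and its row vertices labelled from $1$ to $l$ (columns from left to right, rows from bottom to top). Each column of the trunk contains one column vertex and one row vertex of the trunk, and these are consecutive on a cycle of $\varphi(P)$. To it we associate a $4$-tuple of ordered bicolored trees: at each of these two cycle vertices $v$, the tree formed by $v$ and the descendants hanging from its children that are closer to $v$ than its child on the cycle, and the tree formed by $v$ and the descendants hanging from its children that are farther from $v$ than its child on the cycle. The vertex of the first column of $P$ is marked in these trees (in both black roots, if it lies on a cycle). The map $\psi$ sends $P$ to its intrinsic thickness together with the list of the $l$ $4$-tuples of trees, read from left to right around the cylinder and starting with the $4$-tuple that contains the mark. **Theorem.** Let $P_1$ and $P_2$ be two PPP's such that $\psi(P_1)$ and $\psi(P_2)$ contain exactly the same list of $4$-tuples of trees, and such that the (absolute) difference between the intrinsic thicknesses of $P_1$ and $P_2$ is the width $l\ge 1$ of their trunks, that is, the number of $4$-tuples in the list. Then: (i) $P_1$ and $P_2$ have the same upper path, the same lower path and the same cyclic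 structure; (ii) $P_1$ and $P_2$ have the same width $w$ and the same height $h$, and the (absolute) difference between their areas is $w\times h$. -/

import Mathlib

namespace PPPoly

/-- The two kinds of unit steps of a lattice path. -/
inductive Step
  | north
  | east
  deriving DecidableEq

/-- The number of steps different from `s` that the path `p` makes before its step number `n`
(counted from `0`) of kind `s`.
For `s = east` this is the ordinate of the `n`-th east step of a path that starts at the origin,
for `s = north` it is the abscissa of its `n`-th north step. -/
def offsetOf (s : Step) : List Step → ℕ → ℕ
  | [], _ => 0
  | a :: p, 0 => if a = s then 0 else offsetOf s p 0 + 1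
  | a :: p, n + 1 => if a = s then offsetOf s p n else offsetOf s p (n + 1) + 1

/-- Two lattice paths that start at the origin (written as words from their common starting point
to their end) together with a gluing size. -/
structure GluedPaths where
  upper : List Step
  lower : List Step
  gluing : ℕ

namespace GluedPaths

/-- Number of columns. -/
def width (P : GluedPaths) : ℕ := P.upper.count Step.east

/-- Number of rows before gluing. -/
def fullHeight (P : GluedPaths) : ℕ := P.upper.count Step.north

/-- Number of rows after gluing, i.e. number of rows strictly below the marking of the last
column. -/
def height (P : GluedPaths) : ℕ := P.fullHeight - P.gluing

/-- Column `j` (`0 ≤ j < width`) consists of the cells `(j, i)` with `bot j ≤ i < top j`. -/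
def bot (P : GluedPaths) (j : ℕ) : ℕ := offsetOf Step.east P.lower j

/-- Column `j` (`0 ≤ j < width`) consists of the cells `(j, i)` with `bot j ≤ i < top j`. -/
def top (P : GluedPaths) (j : ℕ) : ℕ := offsetOf Step.east P.upper j

/-- Number of cells. -/
def area (P : GluedPaths) : ℕ := ∑ j ∈ Finset.range P.width, (P.top j - P.bot j)

/-- The two paths bound a parallelogram polyomino: they have the same end point, they meet only at
the starting point and at the end point, `upper` lying above `lower`, and there is a cell between
them. (Two such paths can only meet after the same number of steps.) -/
structure IsParallelogramPolyomino (P : GluedPaths) : Prop where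
  two_le_length : 2 ≤ P.upper.length
  length_eq : P.upper.length = P.lower.length
  end_eq : P.upper.count Step.north = P.lower.count Step.north
  lower_lt_upper : ∀ m, 0 < m → m < P.upper.length →
    (P.lower.take m).count Step.north < (P.upper.take m).count Step.north

/-- The upper boundary path on the cylinder: the upper path without its first `gluing` steps. These
steps are north steps; they form the left side of the glued cells of the first column. -/
def upperPath (P : GluedPaths) : List Step := P.upper.drop P.gluing

/-- The lower boundary path on the cylinder: the lower path without its last `gluing` steps. These
steps are north steps; they form the right side of the glued cells of the last column. -/
def lowerPath (P : GluedPaths) : List Step := P.lower.take (P.lower.length - P.gluing)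

end GluedPaths

/-- Periodic parallelogram polyominoes. -/
structure PPP extends GluedPaths where
  polyomino : toGluedPaths.IsParallelogramPolyomino
  gluing_pos : 0 < toGluedPaths.gluing
  /-- the gluing size is at most the height of the first column -/
  gluing_le_first : toGluedPaths.bot 0 + toGluedPaths.gluing ≤ toGluedPaths.top 0
  /-- the gluing size is at most the height of the last column -/
  gluing_le_last : toGluedPaths.bot (toGluedPaths.width - 1) + toGluedPaths.gluing ≤
    toGluedPaths.top (toGluedPaths.width - 1)
  /-- not a rectangle with gluing size equal to the size of its columns -/
  not_rectangle : ¬ ((∀ j < toGluedPaths.width,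
      toGluedPaths.bot j = 0 ∧ toGluedPaths.top j = toGluedPaths.fullHeight) ∧
    toGluedPaths.gluing = toGluedPaths.fullHeight)

/-- A column or a row of the unrolled cylinder. The unrolled cylinder of `P` is the strip formed by
the translates of `P` by the multiples of `(width, height)`: gluing the bottom `gluing` cells of the
first column to the top `gluing` cells of the last column means that the translate of `P` by
`(width, height)` follows `P`. Columns and rows of the cylinder are columns modulo `width` and rows
modulo `height`.
`col j` stands for the column vertex of column `j` (its top cell), `row i` for the row vertex of row
`i` (its rightmost cell). -/
inductive Vertex
  | col (j : ℤ)
  | row (i : ℤ)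
  deriving DecidableEq

namespace GluedPaths

/-- The row that contains the top cell of column `j` of the unrolled cylinder. -/
def topRow (P : GluedPaths) (j : ℤ) : ℤ :=
  (P.top (j % (P.width : ℤ)).toNat : ℤ) - 1 + (P.height : ℤ) * (j / (P.width : ℤ))

/-- The column that contains the rightmost cell of row `i` of the unrolled cylinder. (For
`0 ≤ i < height`, i.e. for a row strictly below the marking of the last column, this is the column
just to the left of the `i`-th north step of the lower path.) -/
def rightmostCol (P : GluedPaths) (i : ℤ) : ℤ :=
  (offsetOf Step.north P.lower (i % (P.height : ℤ)).toNat : ℤ) - 1 +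
    (P.width : ℤ) * (i / (P.height : ℤ))

/-- The parent of a column vertex is the row vertex of the same row, the parent of a row vertex is
the column vertex of the same column. -/
def parent (P : GluedPaths) : Vertex → Vertex
  | .col j => .row (P.topRow j)
  | .row i => .col (P.rightmostCol i)

/-- The vertex of the cylinder, with columns numbered from `0` to `width - 1` and rows numbered from
`0` to `height - 1`, below a vertex of the unrolled cylinder. -/
def toCylinder (P : GluedPaths) : Vertex → Vertex
  | .col j => .col (j % (P.width : ℤ))
  | .row i => .row (i % (P.height : ℤ))

/-- The rows and columns which are removed when those that correspond to leaves are removed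
recursively: a vertex is removed once all of its children have been removed. -/
inductive Pruned (P : GluedPaths) : Vertex → Prop
  | intro (v : Vertex) : (∀ u, P.parent u = v → Pruned P u) → Pruned P v

/-- Boolean version of `Pruned`. -/
noncomputable def isPruned (P : GluedPaths) (v : Vertex) : Bool :=
  @decide (P.Pruned v) (Classical.propDecidable _)

/-- Removes from a path that starts at the point `(x, y)` the east steps in pruned columns and the
north steps in pruned rows. -/
noncomputable def prunePath (P : GluedPaths) : List Step → ℤ → ℤ → List Step
  | [], _, _ => []
  | .east :: p, x, y =>
      if P.isPruned (.col x) then P.prunePath p (x + 1) y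
      else .east :: P.prunePath p (x + 1) y
  | .north :: p, x, y =>
      if P.isPruned (.row y) then P.prunePath p x (y + 1)
      else .north :: P.prunePath p x (y + 1)

/-- Upper path of the trunk. Remaining rows above the last remaining column have lost all of their
cells there (they survive only further down, in the row they are glued to). -/
noncomputable def trunkUpper (P : GluedPaths) : List Step :=
  (P.prunePath P.upper 0 0).rdropWhile (fun s => s = Step.north)

/-- Number of rows of the cylinder that are not pruned. -/
noncomputable def trunkHeight (P : GluedPaths) : ℕ :=
  ((List.range P.height).filter (fun i => !P.isPruned (.row (i : ℤ)))).length

/-- The trunk: all pruned rows and columns are removed. The gluing size is the difference between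
the numbers of rows before and after gluing. -/
noncomputable def trunk (P : GluedPaths) : GluedPaths where
  upper := P.trunkUpper
  lower := (P.prunePath P.lower 0 0).take P.trunkUpper.length
  gluing := P.trunkUpper.count Step.north - P.trunkHeight

/-- The intrinsic thickness: the gluing size of the trunk. -/
noncomputable def intrinsicThickness (P : GluedPaths) : ℕ := P.trunk.gluing

/-- The cyclic structure: the directed graph (edges from child to parent) of the trunk, whose column
vertices are labelled from left to right and whose row vertices are labelled from bottom to top. It
is given by its set of edges; every vertex has an outgoing edge. -/
noncomputable def cyclicStructure (P : GluedPaths) : Set (Vertex × Vertex) :=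
  Set.range fun v => (P.trunk.toCylinder v, P.trunk.toCylinder (P.trunk.parent v))

end GluedPaths

/-- Column vertices are black, row vertices are white. -/
inductive Color
  | black
  | white
  deriving DecidableEq

/-- Finite rooted ordered trees whose vertices carry a colour and possibly a mark. -/
inductive Tree
  | node (color : Color) (marked : Bool) (children : List Tree)

/-- Two black rooted trees and two white rooted trees. -/
structure FourTuple where
  blackOuter : Tree
  blackInner : Tree
  whiteOuter : Tree
  whiteInner : Tree

namespace GluedPaths

/-- The children of a vertex, the closest one first. The children of a column vertex lie below it,
those of a row vertex lie to the left of it. The length of a row of the unrolled cylinder is at most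
`width * fullHeight`. -/
def children (P : GluedPaths) : Vertex → List Vertex
  | .col j => ((List.range P.fullHeight).map
      (fun d => Vertex.row (P.topRow j - (d : ℤ)))).filter (fun u => P.parent u = .col j)
  | .row i => ((List.range (P.width * P.fullHeight)).map
      (fun d => Vertex.col (P.rightmostCol i - (d : ℤ)))).filter (fun u => P.parent u = .row i)

/-- The colour of a vertex. -/
def color : Vertex → Color
  | .col _ => .black
  | .row _ => .white

/-- The root of the map, i.e. the column vertex of the first column, is marked. -/
def isMarked (P : GluedPaths) (v : Vertex) : Bool := P.toCylinder v = .col 0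

/-- The ordered tree of the descendants of `v` up to depth `n`. -/
def subtree (P : GluedPaths) : ℕ → Vertex → Tree
  | 0, v => .node (color v) (P.isMarked v) []
  | n + 1, v => .node (color v) (P.isMarked v) ((P.children v).map (P.subtree n))

/-- The child of `v` that is not pruned, if `v` is not pruned: the vertex that precedes `v` on its
cycle. -/
noncomputable def cycleChild (P : GluedPaths) (v : Vertex) : Vertex :=
  ((P.children v).dropWhile P.isPruned).headD v

/-- The tree rooted at the cycle vertex `v` in the outer face: its children closer to `v` than the
child on the cycle. (A subtree that hangs from a cycle has fewer than `width + height` vertices.) -/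
noncomputable def outerTree (P : GluedPaths) (v : Vertex) : Tree :=
  .node (color v) (P.isMarked v)
    (((P.children v).takeWhile P.isPruned).map (P.subtree (P.width + P.height)))

/-- The tree rooted at the cycle vertex `v` in the inner face: its children farther from `v` than
the child on the cycle. -/
noncomputable def innerTree (P : GluedPaths) (v : Vertex) : Tree :=
  .node (color v) (P.isMarked v)
    (((P.children v).dropWhile P.isPruned).tail.map (P.subtree (P.width + P.height)))

/-- The four trees rooted at the column vertex and at the row vertex contained in the column `c` of
the trunk. -/
noncomputable def fourTuple (P : GluedPaths) (c : ℤ) : FourTuple where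
  blackOuter := P.outerTree (.col c)
  blackInner := P.innerTree (.col c)
  whiteOuter := P.outerTree (P.cycleChild (.col c))
  whiteInner := P.innerTree (P.cycleChild (.col c))

/-- The column of the trunk whose four trees contain the vertex of the first column: the first
column that is not pruned among the ancestors of the first column. -/
noncomputable def startCol (P : GluedPaths) : ℤ :=
  let f : ℤ → ℤ := fun j => P.rightmostCol (P.topRow j)
  f^[sInf {n : ℕ | ¬ P.Pruned (.col (f^[n] 0))}] 0

/-- The list of `4`-tuples of trees: one for each column of the trunk, from left to right around the
cylinder, starting with the one that contains the marked vertex. -/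
noncomputable def treeList (P : GluedPaths) : List FourTuple :=
  (((List.range P.width).map (fun d => P.startCol + (d : ℤ))).filter
    (fun c => !P.isPruned (.col c))).map P.fourTuple

end GluedPaths

/-- The map `ψ`: the intrinsic thickness and the list of `4`-tuples of trees. -/
noncomputable def psi (P : PPP) : ℕ × List FourTuple :=
  (P.intrinsicThickness, P.treeList)

end PPPoly

namespace PPPoly

/-! ### Lattice paths -/

/-! Unroll the cylinder. Columns and rows become indexed by ℤ, and the polyomino is encoded by two
monotone maps, `topRow` (columns to rows) and `rightmostCol` (rows to columns), each commuting with
translation by one period (`width`, `height`). They define the parent map. The lower path on the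
cylinder can be read off from `rightmostCol`, and the upper path from the differences of `topRow`.
It therefore suffices to show that passing from `P₁` to `P₂`, whose thicknesses differ by `l * e`,
leaves `rightmostCol` unchanged and adds the constant `height * e` to `topRow` (`cylinder_eq`). The
paths then agree, and each of the `width` columns gains `height * e` cells.

Modulo the period the trunk is finite and the parent map sends it onto itself, so this map is a
bijection there (`eq_of_parent_eq`). Being monotone as well, it acts on the trunk columns `c m` as a
rotation `c m ↦ c (m + k)` under the map to the parent of the parent, and `k` is the intrinsic
thickness (`Enumerates.exists_next_eq`, `trunk_spec`).

Replacing `k` by `k + l * e` changes the trunk vertices met going down a cycle only by whole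
periods, which subtrees do not see. Hence equal 4-tuples give equal trees of descendants below `c m`
and `c' m`, to every depth (`similar_of_fourTuple_eq`).

Far enough up, every ancestor lies in the trunk. So for large `s` every column or row of suitable
parity is a descendant, exactly `s` generations down, of a trunk column. Matching the descendants of
`c m` and `c' m` by their positions in the trees is an order-preserving bijection of ℤ, hence a
translation (`Corr.exists_translation`). Comparing the translations in consecutive generations
conjugates the two pairs of maps. The marked vertex and the position of row 0 fix the remaining
constants. -/

theorem count_north_add_count_east (p : List Step) :
    p.count Step.north + p.count Step.east = p.length := by
  induction p with
  | nil => rfl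
  | cons a p ih => cases a <;> simp <;> omega

theorem offsetOf_le_succ (s : Step) (p : List Step) (n : ℕ) :
    offsetOf s p n ≤ offsetOf s p (n + 1) := by
  induction p generalizing n with
  | nil => simp [offsetOf]
  | cons a p ih =>
    cases n with
    | zero => by_cases h : a = s <;> simp [offsetOf, h, ih]
    | succ n => by_cases h : a = s <;> simp [offsetOf, h, ih]

theorem offsetOf_mono (s : Step) (p : List Step) : Monotone (offsetOf s p) :=
  monotone_nat_of_le_succ (offsetOf_le_succ s p)

/-- Past the last step of kind `s`, `offsetOf` returns the number of all other steps, so no bound on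
`n` is needed here or for monotonicity. -/
theorem offsetOf_add_count_le (s : Step) (p : List Step) (n : ℕ) :
    offsetOf s p n + p.count s ≤ p.length := by
  induction p generalizing n with
  | nil => simp [offsetOf]
  | cons a p ih =>
    have := ih n
    cases n with
    | zero =>
      by_cases h : a = s
      · simp only [offsetOf, h, if_true, List.count_cons, List.length_cons, beq_self_eq_true]
        omega
      · simp only [offsetOf, h, if_false, List.count_cons, List.length_cons, beq_iff_eq]
        omega
    | succ n =>
      have := ih n
      by_cases h : a = s
      · simp only [offsetOf, h, if_true, List.count_cons, List.length_cons, beq_self_eq_true]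
        omega
      · simp only [offsetOf, h, if_false, List.count_cons, List.length_cons, beq_iff_eq]
        omega

/-- The step number `n` of kind `s` stands at index `n + offsetOf s p n` of the word. This
translates between prefix counts and offsets. -/
theorem lt_count_take_iff (s : Step) (p : List Step) (n m : ℕ) (hn : n < p.count s) :
    n < (p.take m).count s ↔ n + offsetOf s p n < m := by
  induction p generalizing n m with
  | nil => simp at hn
  | cons a p ih =>
    cases m with
    | zero => simp
    | succ m =>
      by_cases h : a = s
      · cases n with
        | zero => simp [offsetOf, h]
        | succ n =>
          have := ih n m (by simpa [h] using hn)
          simp only [List.take_succ_cons, h, List.count_cons_self, offsetOf, if_true]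
          omega
      · have := ih n m (by simpa [List.count_cons, h] using hn)
        cases n <;> simp only [List.take_succ_cons, List.count_cons, beq_iff_eq, h, offsetOf,
          if_false] <;> omega

theorem offsetOf_take (s : Step) (p : List Step) (n m : ℕ) (hm : n + offsetOf s p n < m) :
    offsetOf s (p.take m) n = offsetOf s p n := by
  induction p generalizing n m with
  | nil => simp
  | cons a p ih =>
    cases m with
    | zero => omega
    | succ m =>
      by_cases h : a = s
      · cases n with
        | zero => simp [offsetOf, h]
        | succ n =>
          simp only [offsetOf, h, if_true, List.take_succ_cons] at hm ⊢
          exact ih n m (by omega)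
      · cases n <;> simp only [offsetOf, h, if_false, List.take_succ_cons] at hm ⊢ <;>
          rw [ih _ m (by omega)]

theorem offsetOf_append (s : Step) (p q : List Step) (n : ℕ) (hn : n < p.count s) :
    offsetOf s (p ++ q) n = offsetOf s p n := by
  induction p generalizing n with
  | nil => simp at hn
  | cons a p ih =>
    by_cases h : a = s
    · cases n with
      | zero => simp [offsetOf, h]
      | succ n =>
        simp only [offsetOf, h, if_true, List.cons_append]
        exact ih n (by simpa [h] using hn)
    · have := ih n (by simpa [List.count_cons, h] using hn)
      cases n <;> simp only [offsetOf, h, if_false, List.cons_append, this]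

theorem offsetOf_append_self (s : Step) (p q : List Step) :
    offsetOf s (p ++ s :: q) (p.count s) + p.count s = p.length := by
  induction p with
  | nil => simp [offsetOf]
  | cons a p ih =>
    by_cases h : a = s
    · simp only [offsetOf, h, if_true, List.cons_append, List.count_cons_self, List.length_cons]
      omega
    · rw [List.count_cons_of_ne h, List.cons_append, List.length_cons]
      cases hc : p.count s with
      | zero => simp only [offsetOf, h, if_false]; rw [hc] at ih; omega
      | succ n => simp only [offsetOf, h, if_false]; rw [hc] at ih; omega

theorem offsetOf_drop (s : Step) (p : List Step) (g : ℕ) (hg : g ≤ offsetOf s p 0) :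
    (∀ n, offsetOf s p n = g + offsetOf s (p.drop g) n) ∧ (p.drop g).count s = p.count s := by
  induction p generalizing g with
  | nil =>
    simp only [offsetOf, Nat.le_zero] at hg
    simp [hg]
  | cons a p ih =>
    cases g with
    | zero => simp
    | succ g =>
      have h : a ≠ s := by
        rintro rfl
        simp [offsetOf] at hg
      obtain ⟨h1, h2⟩ := ih g (by simpa [offsetOf, h] using hg)
      refine ⟨fun n => ?_, ?_⟩
      · cases n <;> simp only [offsetOf, h, if_false, List.drop_succ_cons, h1] <;> omega
      · rw [List.drop_succ_cons, h2, List.count_cons_of_ne h]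

/-- With only two kinds of steps, the positions of the steps of one kind determine the word. -/
theorem path_ext (s : Step) (p q : List Step) (hl : p.length = q.length)
    (hc : p.count s = q.count s)
    (ho : ∀ n < p.count s, offsetOf s p n = offsetOf s q n) : p = q := by
  have two : ∀ a b : Step, a ≠ s → b ≠ s → a = b := by
    intro a b; cases a <;> cases b <;> cases s <;> simp
  have pos : ∀ p : List Step, ∀ a, a ≠ s → offsetOf s (a :: p) 0 ≠ 0 := by
    intro p a ha; simp [offsetOf, ha]
  induction p generalizing q with
  | nil => simpa using hl.symm
  | cons a p ih =>
    cases q with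
    | nil => simp at hl
    | cons b q =>
      simp only [List.length_cons, Nat.add_right_cancel_iff] at hl
      by_cases ha : a = s <;> by_cases hb : b = s
      · subst ha; subst hb
        simp only [List.count_cons_self, Nat.add_right_cancel_iff] at hc
        rw [ih q hl hc fun n hn => by
          have := ho (n + 1) (by simpa using hn)
          simpa [offsetOf] using this]
      · have := ho 0 (by simp [ha])
        exact absurd (this ▸ by simp [offsetOf, ha]) (pos q b hb)
      · have := ho 0 (by rw [hc]; simp [hb])
        exact absurd (this ▸ by simp [offsetOf, hb]) (pos p a ha)
      · rw [two a b ha hb]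
        rw [List.count_cons_of_ne ha] at hc ho
        rw [List.count_cons_of_ne hb] at hc
        rw [ih q hl hc fun n hn => by
          have := ho n hn
          cases n <;> simpa [offsetOf, ha, hb] using this]

/-! ### The unrolled cylinder -/

namespace PPP

variable (P : PPP)

theorem count_upper : P.fullHeight + P.width = P.upper.length :=
  count_north_add_count_east _

theorem count_lower_north : P.lower.count Step.north = P.fullHeight :=
  P.polyomino.end_eq.symm

theorem count_lower_east : P.lower.count Step.east = P.width := by
  have h1 := count_north_add_count_east P.lower
  have h2 := P.count_upper
  have h3 := P.count_lower_north
  have h4 := P.polyomino.length_eq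
  omega

theorem count_take_lower_lt (m : ℕ) (h0 : 0 < m) (h1 : m < P.upper.length) :
    (P.lower.take m).count Step.north < (P.upper.take m).count Step.north :=
  P.polyomino.lower_lt_upper m h0 h1

/-- The upper path ends with an east step: one step before the end the lower path lacks at most one
north step, and the upper path is strictly above it. -/
theorem count_take_upper_last :
    (P.upper.take (P.upper.length - 1)).count Step.north = P.fullHeight := by
  have h2 := P.polyomino.two_le_length
  have h3 := P.count_take_lower_lt (P.upper.length - 1) (by omega) (by omega)
  have h4 : (P.upper.take (P.upper.length - 1)).count Step.north ≤ P.fullHeight :=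
    (List.take_sublist _ _).count_le _
  have h5 : P.lower.count Step.north ≤
      (P.lower.take (P.upper.length - 1)).count Step.north + 1 := by
    conv_lhs => rw [← List.take_append_drop (P.upper.length - 1) P.lower]
    rw [List.count_append]
    have : (P.lower.drop (P.upper.length - 1)).count Step.north ≤ 1 := by
      refine List.count_le_length.trans ?_
      rw [List.length_drop, ← P.polyomino.length_eq]
      omega
    omega
  rw [P.count_lower_north] at h5
  omega

theorem count_take_upper_last_east :
    (P.upper.take (P.upper.length - 1)).count Step.east + 1 = P.width := by
  have h1 := count_north_add_count_east (P.upper.take (P.upper.length - 1))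
  have h2 := P.polyomino.two_le_length
  rw [P.count_take_upper_last, List.length_take] at h1
  have := P.count_upper
  omega

theorem width_pos : 0 < P.width := by
  have := P.count_take_upper_last_east
  omega

theorem top_le (j : ℕ) : P.top j ≤ P.fullHeight := by
  have h1 := offsetOf_add_count_le Step.east P.upper j
  have h2 := P.count_upper
  unfold GluedPaths.top
  unfold GluedPaths.width at h2
  omega

theorem top_last : P.top (P.width - 1) = P.fullHeight := by
  have h1 := P.width_pos
  have h2 := P.count_take_upper_last_east
  have h3 := lt_count_take_iff Step.east P.upper (P.width - 1) (P.upper.length - 1)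
    (by unfold GluedPaths.width at h1 ⊢; omega)
  have h4 := P.top_le (P.width - 1)
  have h5 := P.count_upper
  have h6 : ¬ (P.width - 1 + offsetOf Step.east P.upper (P.width - 1) < P.upper.length - 1) := by
    rw [← h3]; omega
  unfold GluedPaths.top at h4 ⊢
  omega

theorem gluing_le_top (j : ℕ) : P.gluing ≤ P.top j := by
  have h1 := P.gluing_le_first
  have h2 : P.top 0 ≤ P.top j := offsetOf_mono _ _ (Nat.zero_le j)
  omega

/-- Gluing along the full height would force every column to be full, which is the excluded
rectangle. This is what makes `height` positive. -/
theorem gluing_lt : P.gluing < P.fullHeight := by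
  refine lt_of_le_of_ne ((P.gluing_le_top 0).trans (P.top_le 0)) fun h => ?_
  refine P.not_rectangle ⟨fun j hj => ⟨?_, ?_⟩, h⟩
  · have h1 := P.gluing_le_last
    have h2 := P.top_last
    have h3 : P.bot j ≤ P.bot (P.width - 1) := offsetOf_mono _ _ (by omega)
    omega
  · have h1 := P.gluing_le_top j
    have h2 := P.top_le j
    omega

theorem height_pos : 0 < P.height := Nat.sub_pos_of_lt P.gluing_lt

theorem height_add_gluing : P.height + P.gluing = P.fullHeight :=
  Nat.sub_add_cancel P.gluing_lt.le

theorem lower_offset_le (i : ℕ) : offsetOf Step.north P.lower i ≤ P.width := by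
  have h1 := offsetOf_add_count_le Step.north P.lower i
  have h2 := P.count_upper
  have h3 := P.polyomino.length_eq
  rw [P.count_lower_north] at h1
  omega

theorem lower_offset_pos (i : ℕ) : 0 < offsetOf Step.north P.lower i := by
  refine lt_of_lt_of_le ?_ (offsetOf_mono _ _ (Nat.zero_le i))
  have h1 := P.count_take_lower_lt 1 (by omega) P.polyomino.two_le_length
  have h2 := lt_count_take_iff Step.north P.lower 0 1
    (by rw [P.count_lower_north]; have := P.gluing_lt; omega)
  have h3 : (P.upper.take 1).count Step.north ≤ 1 :=
    List.count_le_length.trans (by simp)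
  omega

/-- The column `j` of the polyomino and the next one have a common row. -/
theorem lower_offset_top (j : ℕ) (hj : j < P.width) (hi : P.top j - 1 < P.height) :
    j + 2 ≤ offsetOf Step.north P.lower (P.top j - 1) := by
  have hg := P.gluing_le_top j
  have hg0 := P.gluing_pos
  have hh := P.height_add_gluing
  have hcu := P.count_upper
  have hle := P.polyomino.length_eq
  have hj' : j + 1 < P.width := by
    by_contra hcon
    obtain rfl : j = P.width - 1 := by omega
    rw [P.top_last] at hi
    omega
  have htop := P.top_le j
  have h1 := P.count_take_lower_lt (j + 1 + P.top j) (by omega) (by omega)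
  have h2 := lt_count_take_iff Step.east P.upper j (j + 1 + P.top j) hj
  have h3 : j < (P.upper.take (j + 1 + P.top j)).count Step.east := by
    rw [h2]; unfold GluedPaths.top; omega
  have h4 := count_north_add_count_east (P.upper.take (j + 1 + P.top j))
  rw [List.length_take] at h4
  have h5 := lt_count_take_iff Step.north P.lower (P.top j - 1) (j + 1 + P.top j)
    (by rw [P.count_lower_north]; omega)
  by_contra hcon
  have := h5.2 (by omega)
  omega

theorem topRow_add (j t : ℤ) :
    P.topRow (j + P.width * t) = P.topRow j + P.height * t := by
  have hw : (P.width : ℤ) ≠ 0 := by have := P.width_pos; omega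
  unfold GluedPaths.topRow
  rw [Int.add_mul_emod_self_left, Int.add_mul_ediv_left _ _ hw]
  ring

theorem rightmostCol_add (i t : ℤ) :
    P.rightmostCol (i + P.height * t) = P.rightmostCol i + P.width * t := by
  have hw : (P.height : ℤ) ≠ 0 := by have := P.height_pos; omega
  unfold GluedPaths.rightmostCol
  rw [Int.add_mul_emod_self_left, Int.add_mul_ediv_left _ _ hw]
  ring

theorem topRow_natCast (j : ℕ) (hj : j < P.width) : P.topRow j = (P.top j : ℤ) - 1 := by
  unfold GluedPaths.topRow
  rw [Int.emod_eq_of_lt (by omega) (by omega), Int.ediv_eq_zero_of_lt (by omega) (by omega)]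
  simp

theorem rightmostCol_natCast (i : ℕ) (hi : i < P.height) :
    P.rightmostCol i = (offsetOf Step.north P.lower i : ℤ) - 1 := by
  unfold GluedPaths.rightmostCol
  rw [Int.emod_eq_of_lt (by omega) (by omega), Int.ediv_eq_zero_of_lt (by omega) (by omega)]
  simp

/-- Decomposition of an integer along a period. -/
theorem exists_natCast_add (w : ℕ) (hw : 0 < w) (j : ℤ) :
    ∃ (n : ℕ) (t : ℤ), n < w ∧ j = (n : ℤ) + w * t := by
  refine ⟨(j % w).toNat, j / w, ?_, ?_⟩
  · have := Int.emod_lt_of_pos j (by omega : (0 : ℤ) < w)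
    omega
  · rw [Int.toNat_of_nonneg (Int.emod_nonneg _ (by omega)), Int.emod_add_mul_ediv]

/-- A function that commutes with translations and is monotone on a period, including the passage
to the next period, is monotone. -/
theorem monotone_of_period (f : ℤ → ℤ) (w : ℕ) (hw : 0 < w) (h : ℤ)
    (hf : ∀ j t, f (j + w * t) = f j + h * t)
    (h1 : ∀ n : ℕ, n + 1 < w → f n ≤ f (n + 1 : ℕ))
    (h2 : f (w - 1 : ℕ) ≤ f (0 : ℕ) + h) : Monotone f := by
  refine monotone_int_of_le_succ fun j => ?_
  obtain ⟨n, t, hn, rfl⟩ := exists_natCast_add w hw j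
  rw [hf]
  rcases Nat.lt_or_ge (n + 1) w with hlt | hge
  · have : (n : ℤ) + w * t + 1 = (n + 1 : ℕ) + w * t := by push_cast; ring
    rw [this, hf]
    have := h1 n hlt
    omega
  · obtain rfl : n = w - 1 := by omega
    have : ((w - 1 : ℕ) : ℤ) + w * t + 1 = (0 : ℕ) + w * (t + 1) := by
      rw [Nat.cast_sub hw]; push_cast; ring
    rw [this, hf, mul_add]
    omega

theorem topRow_mono : Monotone P.topRow := by
  have hw := P.width_pos
  refine monotone_of_period _ P.width hw P.height P.topRow_add (fun n hn => ?_) ?_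
  · rw [P.topRow_natCast _ (by omega), P.topRow_natCast _ hn]
    have : P.top n ≤ P.top (n + 1) := offsetOf_mono _ _ (by omega)
    omega
  · rw [P.topRow_natCast _ (by omega), P.topRow_natCast _ hw, P.top_last]
    have h1 := P.height_add_gluing
    have h2 := P.gluing_le_top 0
    omega

theorem rightmostCol_mono : Monotone P.rightmostCol := by
  have hh := P.height_pos
  refine monotone_of_period _ P.height hh P.width P.rightmostCol_add (fun n hn => ?_) ?_
  · rw [P.rightmostCol_natCast _ (by omega), P.rightmostCol_natCast _ hn]
    have : offsetOf Step.north P.lower n ≤ offsetOf Step.north P.lower (n + 1) :=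
      offsetOf_mono _ _ (by omega)
    omega
  · rw [P.rightmostCol_natCast _ (by omega), P.rightmostCol_natCast _ hh]
    have h1 := P.lower_offset_le (P.height - 1)
    have h2 := P.lower_offset_pos 0
    omega

/-- The north steps of the lower path in one period have abscissae between `1` and `width`, so the
periods of rows and of columns begin together. This later pins down the numbering of the rows. -/
theorem rightmostCol_nonneg_iff (i : ℤ) : 0 ≤ P.rightmostCol i ↔ 0 ≤ i := by
  have hh := P.height_pos
  constructor
  · intro h
    by_contra hcon
    have h1 := P.rightmostCol_mono (show i ≤ ((P.height - 1 : ℕ) : ℤ) + P.height * (-1) by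
      rw [Nat.cast_sub hh]; push_cast; omega)
    rw [P.rightmostCol_add, P.rightmostCol_natCast _ (by omega)] at h1
    have h2 := P.lower_offset_le (P.height - 1)
    omega
  · intro h
    have h1 := P.rightmostCol_mono (show ((0 : ℕ) : ℤ) ≤ i by simpa using h)
    rw [P.rightmostCol_natCast _ hh] at h1
    have h2 := P.lower_offset_pos 0
    omega

theorem rightmostCol_ge_iff (i t : ℤ) : P.width * t ≤ P.rightmostCol i ↔ P.height * t ≤ i := by
  have h1 := P.rightmostCol_nonneg_iff (i + P.height * (-t))
  rw [P.rightmostCol_add] at h1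
  constructor
  · intro h
    have := h1.1 (by linarith)
    linarith
  · intro h
    have := h1.2 (by linarith)
    linarith

/-- Going to the parent of the parent moves a column vertex to the right. -/
theorem lt_rightmostCol_topRow (j : ℤ) : j < P.rightmostCol (P.topRow j) := by
  obtain ⟨n, t, hn, rfl⟩ := exists_natCast_add P.width P.width_pos j
  rw [P.topRow_add, P.rightmostCol_add]
  have hg := P.gluing_le_top n
  have hg0 := P.gluing_pos
  have : (n : ℤ) < P.rightmostCol (P.topRow n) := by
    rw [P.topRow_natCast _ hn]
    rcases Nat.lt_or_ge (P.top n - 1) P.height with h | h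
    · have h1 := P.lower_offset_top n hn h
      have h2 := P.rightmostCol_natCast _ h
      rw [Nat.cast_sub (by omega)] at h2
      push_cast at h2
      omega
    · have := (P.rightmostCol_ge_iff ((P.top n : ℤ) - 1) 1).2 (by omega)
      omega
  linarith

theorem lt_topRow_rightmostCol (i : ℤ) : i < P.topRow (P.rightmostCol i) := by
  by_contra hcon
  have h1 := P.rightmostCol_mono (not_lt.1 hcon)
  have h2 := P.lt_rightmostCol_topRow (P.rightmostCol i)
  omega

theorem topRow_sub_lt (i : ℤ) : P.topRow (P.rightmostCol i) - i < P.fullHeight := by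
  obtain ⟨n, t, hn, hj⟩ := exists_natCast_add P.width P.width_pos (P.rightmostCol i)
  have h1 := (P.rightmostCol_ge_iff i t).1 (by omega)
  rw [hj, P.topRow_add, P.topRow_natCast _ hn]
  have := P.top_le n
  omega

theorem rightmostCol_sub_lt (j : ℤ) :
    P.rightmostCol (P.topRow j) - j < (P.width * P.fullHeight : ℕ) := by
  obtain ⟨n, t, hn, rfl⟩ := exists_natCast_add P.width P.width_pos j
  rw [P.topRow_add, P.rightmostCol_add, P.topRow_natCast _ hn]
  -- A crude bound: row `top n - 1` lies below row `height * fullHeight`, so it ends before column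
  -- `width * fullHeight`.
  have h1 : ¬ ((P.width : ℤ) * P.fullHeight ≤ P.rightmostCol ((P.top n : ℤ) - 1)) := by
    rw [P.rightmostCol_ge_iff]
    have h2 := P.top_le n
    have h3 : (P.fullHeight : ℤ) ≤ P.height * P.fullHeight :=
      le_mul_of_one_le_left (by omega) (by have := P.height_pos; omega)
    omega
  push_cast
  omega

/-- Column `-1` is the translate of the last column, and its top is where the truncated upper path
starts. Heights on that path are thus differences of `topRow`. -/
theorem topRow_neg_one : P.topRow (-1) = (P.gluing : ℤ) - 1 := by
  have hw := P.width_pos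
  have h : (-1 : ℤ) = ((P.width - 1 : ℕ) : ℤ) + P.width * (-1) := by
    rw [Nat.cast_sub hw]; push_cast; ring
  rw [h, P.topRow_add, P.topRow_natCast _ (by omega), P.top_last]
  have := P.height_add_gluing
  omega

end PPP
end PPPoly

namespace PPPoly

/-- The number of a column or row. -/
def Vertex.index : Vertex → ℤ
  | .col j => j
  | .row i => i

namespace PPP

variable (P : PPP)

/-! ### Vertices of the unrolled cylinder -/

/-- The translation by `t` periods. -/
def shift (t : ℤ) : Vertex → Vertex
  | .col j => .col (j + P.width * t)
  | .row i => .row (i + P.height * t)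

theorem parent_shift (t : ℤ) (v : Vertex) : P.parent (P.shift t v) = P.shift t (P.parent v) := by
  cases v <;> simp [shift, GluedPaths.parent, topRow_add, rightmostCol_add]

theorem shift_shift (s t : ℤ) (v : Vertex) : P.shift s (P.shift t v) = P.shift (s + t) v := by
  cases v <;> simp only [shift, Vertex.col.injEq, Vertex.row.injEq] <;> ring

theorem shift_zero (v : Vertex) : P.shift 0 v = v := by
  cases v <;> simp [shift]

theorem shift_shift_neg (t : ℤ) (v : Vertex) : P.shift t (P.shift (-t) v) = v := by
  rw [shift_shift, add_neg_cancel, shift_zero]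

theorem shift_neg_shift (t : ℤ) (v : Vertex) : P.shift (-t) (P.shift t v) = v := by
  rw [shift_shift, neg_add_cancel, shift_zero]

theorem shift_injective (t : ℤ) : Function.Injective (P.shift t) :=
  Function.LeftInverse.injective (P.shift_neg_shift t)

theorem eq_of_shift_eq {s t : ℤ} {v : Vertex} (h : P.shift s v = P.shift t v) : s = t := by
  have hw := P.width_pos
  have hh := P.height_pos
  cases v
  · simp only [shift, Vertex.col.injEq, add_right_inj] at h
    exact mul_left_cancel₀ (by omega) h
  · simp only [shift, Vertex.row.injEq, add_right_inj] at h
    exact mul_left_cancel₀ (by omega) h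

theorem parent_iterate_shift (n : ℕ) (t : ℤ) (v : Vertex) :
    P.parent^[n] (P.shift t v) = P.shift t (P.parent^[n] v) :=
  (Function.Commute.iterate_left (fun v => P.parent_shift t v) n) v

theorem exists_shift_toCylinder (v : Vertex) : ∃ t, v = P.shift t (P.toCylinder v) := by
  cases v with
  | col j => exact ⟨j / P.width, by simp [shift, GluedPaths.toCylinder, Int.emod_add_mul_ediv]⟩
  | row i => exact ⟨i / P.height, by simp [shift, GluedPaths.toCylinder, Int.emod_add_mul_ediv]⟩

theorem toCylinder_shift (t : ℤ) (v : Vertex) : P.toCylinder (P.shift t v) = P.toCylinder v := by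
  cases v <;> simp [shift, GluedPaths.toCylinder]

theorem toCylinder_toCylinder (v : Vertex) :
    P.toCylinder (P.toCylinder v) = P.toCylinder v := by
  cases v <;> simp [GluedPaths.toCylinder]

/-- The vertices of the cylinder. -/
def cylinder : Finset Vertex :=
  (Finset.range P.width).image (fun n : ℕ => Vertex.col n) ∪
    (Finset.range P.height).image (fun n : ℕ => Vertex.row n)

theorem card_cylinder_le : P.cylinder.card ≤ P.width + P.height :=
  (Finset.card_union_le _ _).trans (add_le_add
    (Finset.card_image_le.trans (Finset.card_range _).le)
    (Finset.card_image_le.trans (Finset.card_range _).le))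

theorem toCylinder_mem (v : Vertex) : P.toCylinder v ∈ P.cylinder := by
  have hw := P.width_pos
  have hh := P.height_pos
  cases v with
  | col j =>
    have h1 := Int.emod_lt_of_pos j (by omega : (0 : ℤ) < P.width)
    have h2 := Int.emod_nonneg j (by omega : (P.width : ℤ) ≠ 0)
    refine Finset.mem_union_left _ (Finset.mem_image.2 ⟨(j % P.width).toNat, ?_, ?_⟩)
    · rw [Finset.mem_range]; omega
    · simp [GluedPaths.toCylinder, Int.toNat_of_nonneg h2]
  | row i =>
    have h1 := Int.emod_lt_of_pos i (by omega : (0 : ℤ) < P.height)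
    have h2 := Int.emod_nonneg i (by omega : (P.height : ℤ) ≠ 0)
    refine Finset.mem_union_right _ (Finset.mem_image.2 ⟨(i % P.height).toNat, ?_, ?_⟩)
    · rw [Finset.mem_range]; omega
    · simp [GluedPaths.toCylinder, Int.toNat_of_nonneg h2]

/-! ### Children -/

/-- In the definitions a `List ℕ` is coerced to a `List ℤ` by a monadic bind; this turns the
coercion into a `map`. -/
theorem do_cast_eq_map (l : List ℕ) :
    (do let a ← l; pure (a : ℤ)) = l.map (fun a : ℕ => (a : ℤ)) := by
  simp only [List.pure_def, List.bind_eq_flatMap]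
  exact List.flatMap_pure_eq_map _ l

theorem children_col (j : ℤ) : P.children (.col j) = ((List.range P.fullHeight).map
    fun d : ℕ => Vertex.row (P.topRow j - (d : ℤ))).filter (fun u => P.parent u = .col j) := by
  simp only [GluedPaths.children, do_cast_eq_map, List.map_map]
  rfl

theorem children_row (i : ℤ) : P.children (.row i) = ((List.range (P.width * P.fullHeight)).map
    fun d : ℕ => Vertex.col (P.rightmostCol i - (d : ℤ))).filter
      (fun u => P.parent u = .row i) := by
  simp only [GluedPaths.children, do_cast_eq_map, List.map_map]
  rfl

theorem mem_children (u v : Vertex) : u ∈ P.children v ↔ P.parent u = v := by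
  cases v with
  | col j =>
    simp only [children_col, List.mem_filter, List.mem_map, List.mem_range,
      decide_eq_true_eq, and_iff_right_iff_imp]
    intro h
    cases u with
    | col i => simp [GluedPaths.parent] at h
    | row i =>
      simp only [GluedPaths.parent, Vertex.col.injEq] at h
      have h1 := P.lt_topRow_rightmostCol i
      have h2 := P.topRow_sub_lt i
      rw [h] at h1 h2
      exact ⟨(P.topRow j - i).toNat, by omega, by rw [Vertex.row.injEq]; omega⟩
  | row i =>
    simp only [children_row, List.mem_filter, List.mem_map, List.mem_range,
      decide_eq_true_eq, and_iff_right_iff_imp]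
    intro h
    cases u with
    | row i => simp [GluedPaths.parent] at h
    | col j =>
      simp only [GluedPaths.parent, Vertex.row.injEq] at h
      have h1 := P.lt_rightmostCol_topRow j
      have h2 := P.rightmostCol_sub_lt j
      rw [h] at h1 h2
      exact ⟨(P.rightmostCol i - j).toNat, by omega, by rw [Vertex.col.injEq]; omega⟩

theorem children_sorted (v : Vertex) :
    (P.children v).Pairwise (fun a b => b.index < a.index) := by
  cases v <;>
  · simp only [children_col, children_row]
    refine List.Pairwise.filter _ (List.pairwise_map.2 ?_)
    refine List.pairwise_lt_range.imp fun {a b} h => ?_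
    simp only [Vertex.index]
    omega

theorem children_nodup (v : Vertex) : (P.children v).Nodup :=
  (P.children_sorted v).imp fun h e => by rw [e] at h; exact lt_irrefl _ h

theorem isMarked_shift (t : ℤ) (v : Vertex) : P.isMarked (P.shift t v) = P.isMarked v := by
  simp only [GluedPaths.isMarked, toCylinder_shift]

theorem color_shift (t : ℤ) (v : Vertex) :
    GluedPaths.color (P.shift t v) = GluedPaths.color v := by
  cases v <;> rfl

theorem children_shift (t : ℤ) (v : Vertex) :
    P.children (P.shift t v) = (P.children v).map (P.shift t) := by
  have key : ∀ (l : List Vertex) (v : Vertex),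
      (l.map (P.shift t)).filter (fun u => P.parent u = P.shift t v) =
        (l.filter (fun u => P.parent u = v)).map (P.shift t) := by
    intro l v
    rw [List.filter_map]
    congr 1
    refine List.filter_congr fun u _ => ?_
    simp only [Function.comp, parent_shift, (P.shift_injective t).eq_iff]
  cases v with
  | col j =>
    have := key ((List.range P.fullHeight).map fun d : ℕ => Vertex.row (P.topRow j - (d : ℤ))) (.col j)
    simp only [children_col, shift] at this ⊢
    rw [← this, List.map_map]
    congr 2
    funext d
    simp only [Function.comp, shift, topRow_add]
    congr 1
    ring
  | row i =>
    have := key ((List.range (P.width * P.fullHeight)).map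
      fun d : ℕ => Vertex.col (P.rightmostCol i - (d : ℤ))) (.row i)
    simp only [children_row, shift] at this ⊢
    rw [← this, List.map_map]
    congr 2
    funext d
    simp only [Function.comp, shift, rightmostCol_add]
    congr 1
    ring

theorem subtree_shift (t : ℤ) (n : ℕ) (v : Vertex) :
    P.subtree n (P.shift t v) = P.subtree n v := by
  induction n generalizing v with
  | zero => simp only [GluedPaths.subtree, isMarked_shift, color_shift]
  | succ n ih =>
    simp only [GluedPaths.subtree, isMarked_shift, color_shift, children_shift, List.map_map]
    congr 2
    funext u
    exact ih u

/-! ### Pruned vertices -/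

theorem pruned_iff (v : Vertex) : P.Pruned v ↔ ∀ u, P.parent u = v → P.Pruned u :=
  ⟨fun h => by cases h; assumption, .intro v⟩

theorem isPruned_iff (v : Vertex) : P.isPruned v = true ↔ P.Pruned v := by
  simp [GluedPaths.isPruned]

theorem isPruned_eq_false (v : Vertex) : P.isPruned v = false ↔ ¬ P.Pruned v := by
  simp [GluedPaths.isPruned]

theorem not_pruned_parent {v : Vertex} (h : ¬ P.Pruned v) : ¬ P.Pruned (P.parent v) :=
  fun h' => h ((P.pruned_iff _).1 h' v rfl)

theorem not_pruned_parent_iterate {v : Vertex} (h : ¬ P.Pruned v) (n : ℕ) :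
    ¬ P.Pruned (P.parent^[n] v) := by
  induction n with
  | zero => exact h
  | succ n ih => rw [Function.iterate_succ_apply']; exact P.not_pruned_parent ih

theorem exists_not_pruned_child {v : Vertex} (h : ¬ P.Pruned v) :
    ∃ u, P.parent u = v ∧ ¬ P.Pruned u := by
  rw [pruned_iff] at h
  push Not at h
  exact h

theorem Pruned.shift {v : Vertex} (h : P.Pruned v) (t : ℤ) : P.Pruned (P.shift t v) := by
  induction h with
  | intro v _ ih =>
    refine .intro _ fun u hu => ?_
    have := ih (P.shift (-t) u) (by rw [parent_shift, hu, shift_neg_shift])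
    rwa [shift_shift_neg] at this

theorem pruned_shift_iff (t : ℤ) (v : Vertex) : P.Pruned (P.shift t v) ↔ P.Pruned v :=
  ⟨fun h => by simpa only [shift_neg_shift] using Pruned.shift P h (-t),
    fun h => Pruned.shift P h t⟩

/-- A vertex that is periodic up to translation has a child with the same property, its predecessor
on the cycle. This contradicts the well-foundedness of pruning. -/
theorem not_pruned_of_periodic {p : ℕ} (hp : 0 < p) {t : ℤ} {v : Vertex}
    (h : P.parent^[p] v = P.shift t v) : ¬ P.Pruned v := by
  intro hv
  induction hv with
  | intro v _ ih =>
    obtain ⟨q, rfl⟩ : ∃ q, p = q + 1 := ⟨p - 1, by omega⟩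
    refine ih (P.shift (-t) (P.parent^[q] v)) ?_ ?_
    · rw [parent_shift, ← Function.iterate_succ_apply' (f := P.parent), h, shift_neg_shift]
    · rw [parent_iterate_shift, ← Function.iterate_add_apply, add_comm,
        Function.iterate_add_apply, h, parent_iterate_shift, shift_shift, shift_shift, add_comm]

/-- Every vertex has a vertex of the trunk among its close ancestors. -/
theorem not_pruned_iterate (v : Vertex) {n : ℕ} (hn : P.width + P.height ≤ n) :
    ¬ P.Pruned (P.parent^[n] v) := by
  -- Pigeonhole: among the first `n + 1` ancestors, two agree on the cylinder, so the earlier one is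
  -- periodic.
  obtain ⟨a, ha, b, hb, hab, he⟩ := Finset.exists_ne_map_eq_of_card_lt_of_maps_to
    (s := Finset.range (n + 1)) (t := P.cylinder) (f := fun s => P.toCylinder (P.parent^[s] v))
    (by rw [Finset.card_range]; have := P.card_cylinder_le; omega)
    (fun s _ => P.toCylinder_mem _)
  rw [Finset.mem_range] at ha hb
  wlog hlt : a < b generalizing a b
  · exact this b hb a ha hab.symm he.symm (by omega)
  obtain ⟨s, hs⟩ := P.exists_shift_toCylinder (P.parent^[a] v)
  obtain ⟨t, ht⟩ := P.exists_shift_toCylinder (P.parent^[b] v)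
  have key : P.parent^[b - a] (P.parent^[a] v) = P.shift (t - s) (P.parent^[a] v) := by
    rw [← Function.iterate_add_apply, Nat.sub_add_cancel hlt.le, ht, ← he]
    conv_rhs => rw [hs]
    rw [shift_shift, sub_add_cancel]
  have h1 := P.not_pruned_parent_iterate
    (P.not_pruned_of_periodic (by omega) key) (n - a)
  rwa [← Function.iterate_add_apply, Nat.sub_add_cancel (by omega)] at h1

/-- Every trunk vertex has a child in the trunk, so the parent map is a surjection, hence an
injection, of the finite set of trunk vertices modulo the period. Equality of the parents themselves
then forces equal periods. -/
theorem eq_of_parent_eq {u v : Vertex} (hu : ¬ P.Pruned u) (hv : ¬ P.Pruned v)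
    (h : P.parent u = P.parent v) : u = v := by
  let S := {x : Vertex // x ∈ P.cylinder ∧ P.toCylinder x = x ∧ ¬ P.Pruned x}
  have fin : Finite S := Set.Finite.subset P.cylinder.finite_toSet (fun x hx => hx.1)
  have hS : ∀ x, ¬ P.Pruned x → ¬ P.Pruned (P.toCylinder x) := by
    intro x hx
    obtain ⟨t, ht⟩ := P.exists_shift_toCylinder x
    rwa [ht, pruned_shift_iff] at hx
  let mk : ∀ x, ¬ P.Pruned x → S := fun x hx =>
    ⟨P.toCylinder x, P.toCylinder_mem x, P.toCylinder_toCylinder x, hS x hx⟩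
  let f : S → S := fun x => mk (P.parent x.1) (P.not_pruned_parent x.2.2.2)
  have hf : ∀ x (hx : ¬ P.Pruned x), (f (mk x hx)).1 = P.toCylinder (P.parent x) := by
    intro x hx
    obtain ⟨t, ht⟩ := P.exists_shift_toCylinder x
    change P.toCylinder (P.parent (P.toCylinder x)) = _
    conv_rhs => rw [ht, parent_shift, toCylinder_shift]
  have surj : Function.Surjective f := by
    rintro ⟨x, hx1, hx2, hx3⟩
    obtain ⟨y, hy, hy'⟩ := P.exists_not_pruned_child hx3
    refine ⟨mk y hy', Subtype.ext ?_⟩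
    exact (hf y hy').trans ((congrArg P.toCylinder hy).trans hx2)
  have inj := Finite.injective_iff_surjective.2 surj
  have h1 : mk u hu = mk v hv := inj (Subtype.ext (((hf u hu).trans (congrArg P.toCylinder h)).trans
    (hf v hv).symm))
  have h2 : P.toCylinder u = P.toCylinder v := congrArg Subtype.val h1
  obtain ⟨s, hs⟩ := P.exists_shift_toCylinder u
  obtain ⟨t, ht⟩ := P.exists_shift_toCylinder v
  rw [h2] at hs
  have hst : s = t := by
    rw [hs, ht, toCylinder_shift, toCylinder_toCylinder, parent_shift, parent_shift] at h
    exact P.eq_of_shift_eq h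
  exact hs.trans ((congrArg (P.shift · _) hst).trans ht.symm)

/-- The children of a vertex of the trunk: one of them belongs to the trunk. -/
theorem exists_children_eq {v : Vertex} (hv : ¬ P.Pruned v) :
    ∃ l₁ l₂, P.children v = l₁ ++ P.cycleChild v :: l₂ ∧
      (P.children v).takeWhile P.isPruned = l₁ ∧
      ((P.children v).dropWhile P.isPruned).tail = l₂ ∧
      (∀ u ∈ l₁, P.Pruned u) ∧ (∀ u ∈ l₂, P.Pruned u) ∧ ¬ P.Pruned (P.cycleChild v) := by
  obtain ⟨u, hu, hu'⟩ := P.exists_not_pruned_child hv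
  have hne : (P.children v).dropWhile P.isPruned ≠ [] := by
    intro h0
    rw [List.dropWhile_eq_nil_iff] at h0
    exact hu' ((P.isPruned_iff u).1 (h0 u ((P.mem_children u v).2 hu)))
  obtain ⟨d, l₂, hd⟩ := List.exists_cons_of_ne_nil hne
  have hcd : P.cycleChild v = d := by simp [GluedPaths.cycleChild, hd]
  have hsplit : P.children v = (P.children v).takeWhile P.isPruned ++ d :: l₂ := by
    rw [← hd, List.takeWhile_append_dropWhile]
  have hdp : ¬ P.Pruned d := by
    have := List.head_dropWhile_not P.isPruned hne
    simp only [hd, List.head_cons] at this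
    exact (P.isPruned_eq_false d).1 this
  have hdm : P.parent d = v := (P.mem_children d v).1 (by rw [hsplit]; simp)
  refine ⟨_, l₂, by rw [hcd]; exact hsplit, rfl, by simp [hd], fun x hx => ?_, fun x hx => ?_,
    by rwa [hcd]⟩
  · exact (P.isPruned_iff x).1 (List.mem_takeWhile_imp hx)
  · by_contra hxp
    have hxm : P.parent x = v := (P.mem_children x v).1 (by rw [hsplit]; simp [hx])
    have := P.eq_of_parent_eq hxp hdp (hxm.trans hdm.symm)
    have hnd := P.children_nodup v
    rw [hsplit] at hnd
    have := (List.nodup_cons.1 (List.nodup_append.1 hnd).2.1).1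
    exact this (by subst x; exact hx)

theorem not_pruned_cycleChild {v : Vertex} (hv : ¬ P.Pruned v) : ¬ P.Pruned (P.cycleChild v) := by
  obtain ⟨_, _, _, _, _, _, _, h⟩ := P.exists_children_eq hv
  exact h

theorem parent_cycleChild {v : Vertex} (hv : ¬ P.Pruned v) : P.parent (P.cycleChild v) = v := by
  obtain ⟨_, _, h, _⟩ := P.exists_children_eq hv
  exact (P.mem_children _ _).1 (by rw [h]; simp)

theorem cycleChild_parent {v : Vertex} (hv : ¬ P.Pruned v) : P.cycleChild (P.parent v) = v :=
  P.eq_of_parent_eq (P.not_pruned_cycleChild (P.not_pruned_parent hv)) hv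
    (P.parent_cycleChild (P.not_pruned_parent hv))

/-- The trees that hang from a vertex outside the trunk are completely contained in `subtree n` for
large `n`. -/
theorem subtree_eq_of_iterate_ne {v : Vertex} {m : ℕ} (h : ∀ u, P.parent^[m] u ≠ v) {n : ℕ}
    (hn : m ≤ n) : P.subtree n v = P.subtree m v := by
  induction m generalizing v n with
  | zero => exact absurd rfl (h v)
  | succ m ih =>
    obtain ⟨n, rfl⟩ : ∃ k, n = k + 1 := ⟨n - 1, by omega⟩
    simp only [GluedPaths.subtree]
    congr 1
    refine List.map_congr_left fun x hx => ih (fun u hu => ?_) (by omega)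
    refine h u ?_
    rw [Function.iterate_succ_apply', hu]
    exact (P.mem_children x v).1 hx

theorem subtree_eq_of_pruned {v : Vertex} (hv : P.Pruned v) {n : ℕ}
    (hn : P.width + P.height ≤ n) : P.subtree n v = P.subtree (P.width + P.height) v :=
  P.subtree_eq_of_iterate_ne (fun u hu => P.not_pruned_iterate u le_rfl (hu ▸ hv)) hn

end PPP
end PPPoly

/-! ### The trunk as a periodic sequence of columns -/

namespace PPPoly

/-- A relation between integers that is total on both sides and respects the order is the graph of
a translation. -/
theorem exists_translation (r : ℤ → ℤ → Prop) (hl : ∀ x, ∃ y, r x y) (hr : ∀ y, ∃ x, r x y)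
    (hm : ∀ x y x' y', r x y → r x' y' → (x < x' ↔ y < y')) :
    ∃ a, ∀ x y, r x y ↔ y = x + a := by
  choose f hf using hl
  have huniq : ∀ x y, r x y → y = f x := fun x y h => by
    have h1 := hm x y x _ h (hf x)
    have h2 := hm x _ x y (hf x) h
    omega
  -- The element `z` related to `f x + 1` lies above `x`, and no integer lies strictly between `f x`
  -- and `f x + 1`; so `z = x + 1`.
  have hsucc : ∀ x, f (x + 1) = f x + 1 := fun x => by
    obtain ⟨z, hz⟩ := hr (f x + 1)
    have h1 := hm x _ z _ (hf x) hz
    have h2 := hm x _ (x + 1) _ (hf x) (hf (x + 1))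
    have h3 := hm z _ (x + 1) _ hz (hf (x + 1))
    omega
  have hfx : ∀ x, f x = x + f 0 := fun x => by
    induction x using Int.induction_on with
    | zero => simp
    | succ n ih => rw [hsucc, ih]; ring
    | pred n ih =>
      have := hsucc (-(n : ℤ) - 1)
      rw [sub_add_cancel, ih] at this
      omega
  exact ⟨f 0, fun x y => ⟨fun h => (huniq x y h).trans (hfx x), fun h => by
    rw [h, ← hfx]; exact hf x⟩⟩

namespace PPP

variable (P : PPP)

/-- `c` lists the columns of the unrolled trunk from left to right; there are `l` of them in each
period. -/
structure Enumerates (c : ℤ → ℤ) (l : ℕ) : Prop where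
  pos : 0 < l
  mono : StrictMono c
  not_pruned : ∀ m, ¬ P.Pruned (.col (c m))
  surj : ∀ j, ¬ P.Pruned (.col j) → ∃ m, c m = j
  period : ∀ m t, c (m + l * t) = c m + P.width * t

/-- The column of the parent of the parent. -/
def next (j : ℤ) : ℤ := P.rightmostCol (P.topRow j)

theorem parent_parent_col (j : ℤ) : P.parent (P.parent (.col j)) = .col (P.next j) := rfl

theorem parent_iterate_col (n : ℕ) (j : ℤ) :
    P.parent^[2 * n] (.col j) = .col (P.next^[n] j) := by
  induction n generalizing j with
  | zero => rfl
  | succ n ih =>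
    rw [mul_add, Function.iterate_add_apply, Function.iterate_succ_apply P.next]
    exact ih _

theorem next_mono : Monotone P.next := P.rightmostCol_mono.comp P.topRow_mono

/-- The columns of the trunk among `width` consecutive columns. -/
noncomputable def trunkColumns (s : ℤ) : List ℤ :=
  ((List.range P.width).map (fun d : ℕ => s + (d : ℤ))).filter
    (fun c => !P.isPruned (.col c))

theorem mem_trunkColumns (s j : ℤ) :
    j ∈ P.trunkColumns s ↔ s ≤ j ∧ j < s + P.width ∧ ¬ P.Pruned (.col j) := by
  simp only [trunkColumns, List.mem_filter, List.mem_map, List.mem_range, Bool.not_eq_true',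
    isPruned_eq_false]
  constructor
  · rintro ⟨⟨d, hd, rfl⟩, h⟩
    exact ⟨by omega, by omega, h⟩
  · rintro ⟨h1, h2, h⟩
    exact ⟨⟨(j - s).toNat, by omega, by omega⟩, h⟩

theorem trunkColumns_sorted (s : ℤ) : (P.trunkColumns s).Pairwise (· < ·) := by
  refine List.Pairwise.filter _ (List.pairwise_map.2 ?_)
  exact List.pairwise_lt_range.imp fun {a b} h => by omega

theorem exists_mem_trunkColumns (s : ℤ) {j : ℤ} (hj : ¬ P.Pruned (.col j)) :
    ∃ x ∈ P.trunkColumns s, ∃ t : ℤ, j = x + P.width * t := by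
  have hw := P.width_pos
  refine ⟨s + (j - s) % P.width, ?_, (j - s) / P.width, ?_⟩
  · have h1 := Int.emod_lt_of_pos (j - s) (by omega : (0 : ℤ) < P.width)
    have h2 := Int.emod_nonneg (j - s) (by omega : (P.width : ℤ) ≠ 0)
    refine (P.mem_trunkColumns _ _).2 ⟨by omega, by omega, ?_⟩
    rw [← P.pruned_shift_iff ((j - s) / P.width), shift, add_assoc, Int.emod_add_mul_ediv]
    simpa using hj
  · rw [add_assoc, Int.emod_add_mul_ediv]; ring

theorem trunkColumns_length_pos (s : ℤ) : 0 < (P.trunkColumns s).length := by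
  have h := P.not_pruned_iterate (.col 0) (n := 2 * (P.width + P.height)) (by omega)
  rw [parent_iterate_col] at h
  obtain ⟨x, hx, _⟩ := P.exists_mem_trunkColumns s h
  exact List.length_pos_of_mem hx

theorem exists_enumerates (s : ℤ) : ∃ c, P.Enumerates c (P.trunkColumns s).length ∧
    ∀ q (h : q < (P.trunkColumns s).length), c q = (P.trunkColumns s)[q] := by
  set L := P.trunkColumns s with hL
  have hlen : 0 < L.length := P.trunkColumns_length_pos s
  have hlz : (L.length : ℤ) ≠ 0 := by omega
  have hmem : ∀ q (h : q < L.length), s ≤ L[q] ∧ L[q] < s + P.width ∧ ¬ P.Pruned (.col L[q]) :=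
    fun q h => (P.mem_trunkColumns s _).1 (List.getElem_mem h)
  let c : ℤ → ℤ := fun m => L.getD (m % L.length).toNat 0 + P.width * (m / L.length)
  have hc : ∀ q (h : q < L.length) (t : ℤ), c (q + L.length * t) = L[q] + P.width * t := by
    intro q h t
    simp only [c]
    rw [Int.add_mul_emod_self_left, Int.add_mul_ediv_left _ _ hlz,
      Int.emod_eq_of_lt (by omega) (by omega), Int.ediv_eq_zero_of_lt (by omega) (by omega),
      Int.toNat_natCast, List.getD_eq_getElem _ _ h, zero_add]
  have hc0 : ∀ q (h : q < L.length), c q = L[q] := fun q h => by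
    have := hc q h 0
    simpa using this
  refine ⟨c, ⟨hlen, ?_, ?_, ?_, ?_⟩, hc0⟩
  · refine strictMono_int_of_lt_succ fun m => ?_
    obtain ⟨q, t, hq, rfl⟩ := exists_natCast_add L.length hlen m
    rw [hc q hq]
    rcases Nat.lt_or_ge (q + 1) L.length with h | h
    · have : (q : ℤ) + L.length * t + 1 = (q + 1 : ℕ) + L.length * t := by push_cast; ring
      rw [this, hc _ h]
      have := List.pairwise_iff_getElem.1 (P.trunkColumns_sorted s) q (q + 1) hq h (by omega)
      linarith
    · have : (q : ℤ) + L.length * t + 1 = (0 : ℕ) + L.length * (t + 1) := by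
        have : (q : ℤ) + 1 = L.length := by omega
        push_cast
        linarith
      rw [this, hc _ hlen]
      have h1 := (hmem q hq).2.1
      have h2 := (hmem 0 hlen).1
      linarith
  · intro m
    obtain ⟨q, t, hq, rfl⟩ := exists_natCast_add L.length hlen m
    rw [hc q hq]
    exact (P.pruned_shift_iff t (.col L[q])).not.2 (hmem q hq).2.2
  · intro j hj
    obtain ⟨x, hx, t, rfl⟩ := P.exists_mem_trunkColumns s hj
    obtain ⟨q, hq, rfl⟩ := List.getElem_of_mem hx
    exact ⟨_, hc q hq t⟩
  · intro m t
    obtain ⟨q, u, hq, rfl⟩ := exists_natCast_add L.length hlen m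
    rw [add_assoc, ← mul_add, hc q hq, hc q hq]
    ring

variable {P} in
theorem Enumerates.exists_eq_add {c c' : ℤ → ℤ} {l l' : ℕ} (h : P.Enumerates c l)
    (h' : P.Enumerates c' l') : l = l' ∧ ∃ a, ∀ m, c' (m + a) = c m := by
  obtain ⟨a, ha⟩ := exists_translation (fun x y => c' y = c x)
    (fun x => h'.surj _ (h.not_pruned x))
    (fun y => by obtain ⟨x, hx⟩ := h.surj _ (h'.not_pruned y); exact ⟨x, hx.symm⟩)
    (fun x y x' y' e e' => by rw [← h.mono.lt_iff_lt, ← e, ← e', h'.mono.lt_iff_lt])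
  have ha' : ∀ m, c' (m + a) = c m := fun m => (ha m _).2 rfl
  refine ⟨?_, a, ha'⟩
  have h1 := h.period 0 1
  rw [← ha', ← ha', ← h'.period] at h1
  have := h'.mono.injective h1
  omega

variable {P} in
/-- The map to the parent of the parent rotates the trunk. -/
theorem Enumerates.exists_next_eq {c : ℤ → ℤ} {l : ℕ} (h : P.Enumerates c l) :
    ∃ k, ∀ m, P.next (c m) = c (m + k) := by
  have hnp : ∀ m, ¬ P.Pruned (.col (P.next (c m))) := fun m =>
    P.not_pruned_parent (P.not_pruned_parent (h.not_pruned m))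
  have hinj : ∀ m m', P.next (c m) = P.next (c m') → m = m' := fun m m' e => by
    have h1 := P.eq_of_parent_eq (P.not_pruned_parent (h.not_pruned m))
      (P.not_pruned_parent (h.not_pruned m')) (congrArg Vertex.col e)
    have h2 := P.eq_of_parent_eq (h.not_pruned m) (h.not_pruned m') h1
    exact h.mono.injective (Vertex.col.inj h2)
  -- Injectivity on the trunk makes the monotone map `next` strictly monotone there, as needed for a
  -- translation of indices.
  have hmono : StrictMono fun m => P.next (c m) :=
    (P.next_mono.comp h.mono.monotone).strictMono_of_injective hinj
  obtain ⟨k, hk⟩ := exists_translation (fun x y => c y = P.next (c x))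
    (fun x => h.surj _ (hnp x))
    (fun y => by
      have h1 := P.not_pruned_cycleChild (h.not_pruned y)
      have h2 := P.not_pruned_cycleChild h1
      have h3 := P.parent_cycleChild h1
      have h4 := P.parent_cycleChild (h.not_pruned y)
      rw [← h3] at h4
      generalize P.cycleChild (P.cycleChild (.col (c y))) = u at h2 h4
      cases u with
      | row i => cases h4
      | col j =>
        obtain ⟨m, rfl⟩ := h.surj _ h2
        exact ⟨m, (Vertex.col.inj h4).symm⟩)
    (fun x y x' y' e e' => by rw [← hmono.lt_iff_lt, ← e, ← e', h.mono.lt_iff_lt])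
  exact ⟨k, fun m => ((hk m _).2 rfl).symm⟩

theorem next_iterate {c : ℤ → ℤ} {k : ℤ} (hk : ∀ m, P.next (c m) = c (m + k)) (n : ℕ) (m : ℤ) :
    P.next^[n] (c m) = c (m + n * k) := by
  induction n generalizing m with
  | zero => simp
  | succ n ih =>
    rw [Function.iterate_succ_apply, hk, ih]
    congr 1
    push_cast
    ring

variable {P} in
theorem Enumerates.parent_cycleChild_cycleChild {c : ℤ → ℤ} {l : ℕ} (h : P.Enumerates c l) {k : ℤ}
    (hk : ∀ m, P.next (c m) = c (m + k)) (m : ℤ) :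
    P.cycleChild (P.cycleChild (.col (c m))) = .col (c (m - k)) := by
  have h1 := hk (m - k)
  rw [sub_add_cancel] at h1
  rw [← h1, ← parent_parent_col,
    P.cycleChild_parent (P.not_pruned_parent (h.not_pruned _)), P.cycleChild_parent
    (h.not_pruned _)]

theorem cycleChild_shift {v : Vertex} (hv : ¬ P.Pruned v) (t : ℤ) :
    P.cycleChild (P.shift t v) = P.shift t (P.cycleChild v) := by
  conv_lhs => rw [← P.parent_cycleChild hv, ← parent_shift]
  exact P.cycleChild_parent ((P.pruned_shift_iff _ _).not.2 (P.not_pruned_cycleChild hv))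

end PPP

/-! ### Vertices with the same descendants -/

theorem map_eq_map_of_imp {α β γ δ : Type*} {f : α → γ} {f' : β → γ} {g : α → δ} {g' : β → δ}
    {l : List α} {l' : List β} (h : l.map f = l'.map f')
    (hi : ∀ u ∈ l, ∀ u' ∈ l', f u = f' u' → g u = g' u') : l.map g = l'.map g' := by
  induction l generalizing l' with
  | nil => cases l' <;> simp_all
  | cons a l ih =>
    cases l' with
    | nil => simp at h
    | cons b l' =>
      simp only [List.map_cons, List.cons.injEq] at h ⊢
      exact ⟨hi a (by simp) b (by simp) h.1,
        ih h.2 fun u hu u' hu' => hi u (by simp [hu]) u' (by simp [hu'])⟩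

theorem subtree_eq_of_succ (P P' : GluedPaths) {n : ℕ} {v v' : Vertex}
    (h : P.subtree (n + 1) v = P'.subtree (n + 1) v') : P.subtree n v = P'.subtree n v' := by
  induction n generalizing v v' with
  | zero =>
    simp only [GluedPaths.subtree, Tree.node.injEq] at h ⊢
    exact ⟨h.1, h.2.1, trivial⟩
  | succ n ih =>
    rw [GluedPaths.subtree, GluedPaths.subtree, Tree.node.injEq] at h ⊢
    exact ⟨h.1, h.2.1, map_eq_map_of_imp h.2.2 fun u _ u' _ => ih⟩

theorem subtree_eq_of_le (P P' : GluedPaths) {n m : ℕ} (hnm : n ≤ m) {v v' : Vertex}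
    (h : P.subtree m v = P'.subtree m v') : P.subtree n v = P'.subtree n v' := by
  induction hnm with
  | refl => exact h
  | step _ ih => exact ih (subtree_eq_of_succ P P' h)

/-- The vertices `v` of `P` and `v'` of `P'` have the same descendants. -/
def Similar (P P' : GluedPaths) (v v' : Vertex) : Prop :=
  ∀ n, P.subtree n v = P'.subtree n v'

theorem Similar.symm {P P' : GluedPaths} {v v' : Vertex} (h : Similar P P' v v') :
    Similar P' P v' v := fun n => (h n).symm

theorem Similar.color_eq {P P' : GluedPaths} {v v' : Vertex} (h : Similar P P' v v') :
    GluedPaths.color v = GluedPaths.color v' := (Tree.node.inj (h 0)).1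

theorem Similar.isMarked_eq {P P' : GluedPaths} {v v' : Vertex} (h : Similar P P' v v') :
    P.isMarked v = P'.isMarked v' := (Tree.node.inj (h 0)).2.1

theorem Similar.map_children {P P' : GluedPaths} {v v' : Vertex} (h : Similar P P' v v') (n : ℕ) :
    (P.children v).map (P.subtree n) = (P'.children v').map (P'.subtree n) :=
  (Tree.node.inj (h (n + 1))).2.2

theorem Similar.length_children {P P' : GluedPaths} {v v' : Vertex} (h : Similar P P' v v') :
    (P.children v).length = (P'.children v').length := by
  simpa using congrArg List.length (h.map_children 0)

theorem Similar.children {P P' : GluedPaths} {v v' : Vertex} (h : Similar P P' v v') {q : ℕ}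
    {u u' : Vertex} (hu : (P.children v)[q]? = some u) (hu' : (P'.children v')[q]? = some u') :
    Similar P P' u u' := fun n => by
  have := congrArg (·[q]?) (h.map_children n)
  simpa [hu, hu'] using this

theorem similar_of_pruned (P P' : PPP) {v v' : Vertex} (hv : P.Pruned v) (hv' : P'.Pruned v')
    (h : P.subtree (P.width + P.height) v = P'.subtree (P'.width + P'.height) v') :
    Similar P.toGluedPaths P'.toGluedPaths v v' := by
  intro n
  set m := max n (max (P.width + P.height) (P'.width + P'.height)) with hm
  refine subtree_eq_of_le _ _ (show n ≤ m by omega) ?_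
  rw [P.subtree_eq_of_pruned hv (by omega), P'.subtree_eq_of_pruned hv' (by omega), h]

theorem Similar.pruned {P P' : PPP} {v v' : Vertex}
    (h : Similar P.toGluedPaths P'.toGluedPaths v v') (hv : P.Pruned v) : P'.Pruned v' := by
  induction hv generalizing v' with
  | intro v _ ih =>
    refine .intro _ fun u' hu' => ?_
    obtain ⟨q, hq, hqu⟩ := List.getElem_of_mem ((P'.mem_children u' v').2 hu')
    have hq' : q < (P.children v).length := by rw [h.length_children]; exact hq
    exact ih _ ((P.mem_children _ v).1 (List.getElem_mem hq'))
      (h.children (List.getElem?_eq_getElem hq') (by rw [List.getElem?_eq_getElem hq, hqu]))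

theorem Similar.pruned_iff {P P' : PPP} {v v' : Vertex}
    (h : Similar P.toGluedPaths P'.toGluedPaths v v') : P.Pruned v ↔ P'.Pruned v' :=
  ⟨h.pruned, h.symm.pruned⟩

/-- Two vertices of the trunk have the same descendants up to a certain depth if this holds for
the trees at them and for their children in the trunk. -/
theorem subtree_succ_eq (P P' : PPP) {v v' : Vertex} (hv : ¬ P.Pruned v) (hv' : ¬ P'.Pruned v')
    (ho : P.outerTree v = P'.outerTree v') (hi : P.innerTree v = P'.innerTree v') {n : ℕ}
    (hc : P.subtree n (P.cycleChild v) = P'.subtree n (P'.cycleChild v')) :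
    P.subtree (n + 1) v = P'.subtree (n + 1) v' := by
  obtain ⟨l₁, l₂, h, h1, h2, hp1, hp2, -⟩ := P.exists_children_eq hv
  obtain ⟨l₁', l₂', h', h1', h2', hp1', hp2', -⟩ := P'.exists_children_eq hv'
  rw [GluedPaths.outerTree, GluedPaths.outerTree, h1, h1', Tree.node.injEq] at ho
  rw [GluedPaths.innerTree, GluedPaths.innerTree, h2, h2', Tree.node.injEq] at hi
  rw [GluedPaths.subtree, GluedPaths.subtree, Tree.node.injEq]
  refine ⟨ho.1, ho.2.1, ?_⟩
  rw [h, h']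
  simp only [List.map_append, List.map_cons]
  rw [map_eq_map_of_imp ho.2.2 fun u hu u' hu' e =>
    similar_of_pruned P P' (hp1 u hu) (hp1' u' hu') e n,
    map_eq_map_of_imp hi.2.2 fun u hu u' hu' e =>
    similar_of_pruned P P' (hp2 u hu) (hp2' u' hu') e n, hc]

/-- Induction on the depth, for the column vertex and its cycle child together. Each tree is made of
the given outer and inner trees and of the tree at the next vertex down the cycle, which is one
level shallower. -/
theorem similar_of_fourTuple_eq (P P' : PPP) {c c' : ℤ → ℤ} {l : ℕ} {k k' e : ℤ}
    (hc : P.Enumerates c l) (hc' : P'.Enumerates c' l)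
    (hk : ∀ m, P.next (c m) = c (m + k)) (hk' : ∀ m, P'.next (c' m) = c' (m + k'))
    (hkk : k' = k + l * e)
    (hT : ∀ q : ℕ, q < l → P.fourTuple (c q) = P'.fourTuple (c' q)) (m : ℤ) :
    Similar P.toGluedPaths P'.toGluedPaths (.col (c m)) (.col (c' m)) := by
  have hs : ∀ m t, Vertex.col (c (m + l * t)) = P.shift t (.col (c m)) := fun m t => by
    rw [hc.period]; rfl
  have hs' : ∀ m t, Vertex.col (c' (m + l * t)) = P'.shift t (.col (c' m)) := fun m t => by
    rw [hc'.period]; rfl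
  have extend : ∀ n, (∀ q : ℕ, q < l →
      P.subtree n (.col (c q)) = P'.subtree n (.col (c' q)) ∧
      P.subtree n (P.cycleChild (.col (c q))) = P'.subtree n (P'.cycleChild (.col (c' q)))) →
      ∀ m, P.subtree n (.col (c m)) = P'.subtree n (.col (c' m)) ∧
      P.subtree n (P.cycleChild (.col (c m))) = P'.subtree n (P'.cycleChild (.col (c' m))) := by
    intro n h m
    obtain ⟨q, t, hq, rfl⟩ := PPP.exists_natCast_add l hc.pos m
    rw [hs, hs', P.cycleChild_shift (hc.not_pruned _), P'.cycleChild_shift (hc'.not_pruned _),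
      P.subtree_shift, P'.subtree_shift, P.subtree_shift, P'.subtree_shift]
    exact h q hq
  have key : ∀ n m, P.subtree n (.col (c m)) = P'.subtree n (.col (c' m)) ∧
      P.subtree n (P.cycleChild (.col (c m))) = P'.subtree n (P'.cycleChild (.col (c' m))) := by
    intro n
    induction n with
    | zero =>
      refine extend 0 fun q hq => ?_
      have h := hT q hq
      simp only [GluedPaths.fourTuple, GluedPaths.outerTree, FourTuple.mk.injEq,
        Tree.node.injEq] at h
      simp only [GluedPaths.subtree, Tree.node.injEq]
      exact ⟨⟨h.1.1, h.1.2.1, trivial⟩, ⟨h.2.2.1.1, h.2.2.1.2.1, trivial⟩⟩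
    | succ n ih =>
      refine extend (n + 1) fun q hq => ?_
      have h := hT q hq
      simp only [GluedPaths.fourTuple, FourTuple.mk.injEq] at h
      refine ⟨subtree_succ_eq P P' (hc.not_pruned _) (hc'.not_pruned _) h.1 h.2.1 (ih q).2,
        subtree_succ_eq P P' (P.not_pruned_cycleChild (hc.not_pruned _))
          (P'.not_pruned_cycleChild (hc'.not_pruned _)) h.2.2.1 h.2.2.2 ?_⟩
      rw [hc.parent_cycleChild_cycleChild hk, hc'.parent_cycleChild_cycleChild hk']
      -- Here the difference of the thicknesses matters: being a multiple of `l`, it shifts the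
      -- trunk column reached by whole periods, and subtrees are invariant under such shifts.
      have : (q : ℤ) - k' = q - k + l * (-e) := by rw [hkk]; ring
      rw [this, hs', P'.subtree_shift]
      exact (ih _).1
  exact fun n => (key n m).1

end PPPoly

/-! ### Matching descendants in the two cylinders -/

namespace PPPoly

/-- `v` lies to the left of `u` or below `u`. -/
def Vertex.Lt : Vertex → Vertex → Prop
  | .col j, .col j' => j < j'
  | .row i, .row i' => i < i'
  | _, _ => False

theorem Vertex.Lt.irrefl (v : Vertex) : ¬ v.Lt v := by
  cases v <;> exact lt_irrefl _

theorem Vertex.Lt.asymm {v u : Vertex} (h : v.Lt u) : ¬ u.Lt v := by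
  cases v <;> cases u <;> first | exact lt_asymm h | exact h.elim

namespace PPP

variable (P : PPP)

theorem lt_of_parent_lt {v u : Vertex} (h : (P.parent v).Lt (P.parent u)) : v.Lt u := by
  cases v <;> cases u <;> first | exact h.elim | skip
  · exact P.topRow_mono.reflect_lt h
  · exact P.rightmostCol_mono.reflect_lt h

theorem parent_lt_or_eq {v u : Vertex} (h : v.Lt u) :
    (P.parent v).Lt (P.parent u) ∨ P.parent v = P.parent u := by
  cases v <;> cases u <;> first | exact h.elim | skip
  · exact (P.topRow_mono (le_of_lt h)).lt_or_eq.imp id (congrArg Vertex.row)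
  · exact (P.rightmostCol_mono (le_of_lt h)).lt_or_eq.imp id (congrArg Vertex.col)

theorem children_lt {v u u' : Vertex} {q q' : ℕ} (hu : (P.children v)[q]? = some u)
    (hu' : (P.children v)[q']? = some u') (h : q < q') : u'.Lt u := by
  obtain ⟨hq, rfl⟩ := List.getElem?_eq_some_iff.1 hu
  obtain ⟨hq', rfl⟩ := List.getElem?_eq_some_iff.1 hu'
  have h1 := List.pairwise_iff_getElem.1 (P.children_sorted v) q q' hq hq' h
  have h2 := (P.mem_children _ v).1 (List.getElem_mem hq)
  have h3 := (P.mem_children _ v).1 (List.getElem_mem hq')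
  generalize (P.children v)[q] = a at h1 h2
  generalize (P.children v)[q'] = b at h1 h3
  cases a <;> cases b <;> first | exact h1 | (cases v <;> cases h2; cases h3)

end PPP

/-- The descendants of the trunk of `P` and those of the trunk of `P'`, `s` generations below the
columns given by `c` and `c'`, which have corresponding positions. -/
def Corr (P P' : PPP) (c c' : ℤ → ℤ) : ℕ → Vertex → Vertex → Prop
  | 0, v, v' => ∃ m, v = .col (c m) ∧ v' = .col (c' m)
  | s + 1, v, v' => Corr P P' c c' s (P.parent v) (P'.parent v') ∧
      ∃ q : ℕ, (P.children (P.parent v))[q]? = some v ∧ (P'.children (P'.parent v'))[q]? = some v'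

namespace Corr

variable {P P' : PPP} {c c' : ℤ → ℤ} {s : ℕ} {u u' v v' : Vertex}

theorem symm (h : Corr P P' c c' s v v') : Corr P' P c' c s v' v := by
  induction s generalizing v v' with
  | zero => obtain ⟨m, h1, h2⟩ := h; exact ⟨m, h2, h1⟩
  | succ s ih => obtain ⟨h, q, h1, h2⟩ := h; exact ⟨ih h, q, h2, h1⟩

theorem root (h : Corr P P' c c' s v v') :
    ∃ m, P.parent^[s] v = .col (c m) ∧ P'.parent^[s] v' = .col (c' m) := by
  induction s generalizing v v' with
  | zero => exact h
  | succ s ih => exact ih h.1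

theorem similar (hS : ∀ m, Similar P.toGluedPaths P'.toGluedPaths (.col (c m)) (.col (c' m)))
    (h : Corr P P' c c' s v v') : Similar P.toGluedPaths P'.toGluedPaths v v' := by
  induction s generalizing v v' with
  | zero => obtain ⟨m, rfl, rfl⟩ := h; exact hS m
  | succ s ih => obtain ⟨h, q, h1, h2⟩ := h; exact (ih h).children h1 h2

theorem exists_right
    (hS : ∀ m, Similar P.toGluedPaths P'.toGluedPaths (.col (c m)) (.col (c' m)))
    {m : ℤ} (h : P.parent^[s] v = .col (c m)) : ∃ v', Corr P P' c c' s v v' := by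
  induction s generalizing v with
  | zero => exact ⟨_, m, h, rfl⟩
  | succ s ih =>
    obtain ⟨w', hw⟩ := ih h
    obtain ⟨q, hq, hqv⟩ := List.getElem_of_mem ((P.mem_children v _).2 rfl)
    have hq' : q < (P'.children w').length := by rwa [← (similar hS hw).length_children]
    have hp := (P'.mem_children _ w').1 (List.getElem_mem hq')
    refine ⟨(P'.children w')[q], ?_, q, ?_, ?_⟩
    · rwa [hp]
    · rw [List.getElem?_eq_getElem hq, hqv]
    · rw [hp, List.getElem?_eq_getElem hq']

/-- The order within a generation is lexicographic: the order of the parents decides first, then the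
position among siblings, and `Corr` preserves both. -/
theorem order (hc : StrictMono c) (hc' : StrictMono c')
    (h : Corr P P' c c' s v v') (hu : Corr P P' c c' s u u') :
    (v.Lt u → v'.Lt u') ∧ (v = u → v' = u') := by
  induction s generalizing v v' u u' with
  | zero =>
    obtain ⟨m, rfl, rfl⟩ := h
    obtain ⟨n, rfl, rfl⟩ := hu
    refine ⟨fun h => hc' (hc.lt_iff_lt.1 h), fun h => ?_⟩
    rw [hc.injective (Vertex.col.inj h)]
  | succ s ih =>
    obtain ⟨h, q, h1, h2⟩ := h
    obtain ⟨hu, p, hu1, hu2⟩ := hu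
    obtain ⟨i1, i2⟩ := ih h hu
    refine ⟨fun hlt => ?_, ?_⟩
    · rcases P.parent_lt_or_eq hlt with hp | hp
      · exact P'.lt_of_parent_lt (i1 hp)
      · rw [← hp] at hu1
        rw [← i2 hp] at hu2
        refine P'.children_lt hu2 h2 (lt_of_not_ge fun hge => ?_)
        rcases hge.lt_or_eq with hqp | rfl
        · exact hlt.asymm (P.children_lt h1 hu1 hqp)
        · rw [h1] at hu1
          exact Vertex.Lt.irrefl _ (Option.some.inj hu1 ▸ hlt)
    · rintro rfl
      rw [← i2 rfl] at hu2
      obtain ⟨hq, e1⟩ := List.getElem?_eq_some_iff.1 h1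
      obtain ⟨hp, e2⟩ := List.getElem?_eq_some_iff.1 hu1
      have : q = p := (P.children_nodup _).getElem_inj_iff.1 (e1.trans e2.symm)
      rw [this, hu2] at h2
      exact (Option.some.inj h2).symm

theorem lt_iff (hc : StrictMono c) (hc' : StrictMono c')
    (h : Corr P P' c c' s v v') (hu : Corr P P' c c' s u u') : v.Lt u ↔ v'.Lt u' :=
  ⟨(order hc hc' h hu).1, (order hc' hc h.symm hu.symm).1⟩

theorem exists_right_of_le {l : ℕ} (hc : P.Enumerates c l)
    (hS : ∀ m, Similar P.toGluedPaths P'.toGluedPaths (.col (c m)) (.col (c' m)))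
    {n : ℕ} (hn : P.width + P.height ≤ n) (j : ℤ) :
    (∃ j', Corr P P' c c' (2 * n) (.col j) (.col j')) ∧
      ∃ i', Corr P P' c c' (2 * n + 1) (.row j) (.row i') := by
  have key : ∀ s v, P.width + P.height ≤ s → ∀ x, P.parent^[s] v = .col x →
      ∃ v', Corr P P' c c' s v v' := by
    intro s v hs x hx
    have h1 := P.not_pruned_iterate v hs
    rw [hx] at h1
    obtain ⟨m, rfl⟩ := hc.surj _ h1
    exact exists_right hS hx
  constructor
  · obtain ⟨v', hv'⟩ := key (2 * n) (.col j) (by omega) _ (P.parent_iterate_col n j)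
    have := (similar hS hv').color_eq
    cases v' with
    | row i => cases this
    | col j' => exact ⟨j', hv'⟩
  · obtain ⟨v', hv'⟩ := key (2 * n + 1) (.row j) (by omega) _
      (P.parent_iterate_col n (P.rightmostCol j))
    have := (similar hS hv').color_eq
    cases v' with
    | col i => cases this
    | row j' => exact ⟨j', hv'⟩

/-- Sufficiently many generations below the trunk, the correspondence is a translation. -/
theorem exists_translation {l : ℕ} (hc : P.Enumerates c l) (hc' : P'.Enumerates c' l)
    (hS : ∀ m, Similar P.toGluedPaths P'.toGluedPaths (.col (c m)) (.col (c' m)))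
    {n : ℕ} (hn : P.width + P.height ≤ n) (hn' : P'.width + P'.height ≤ n) :
    (∃ a, ∀ x y, Corr P P' c c' (2 * n) (.col x) (.col y) ↔ y = x + a) ∧
      ∃ b, ∀ x y, Corr P P' c c' (2 * n + 1) (.row x) (.row y) ↔ y = x + b := by
  have hS' : ∀ m, Similar P'.toGluedPaths P.toGluedPaths (.col (c' m)) (.col (c m)) :=
    fun m => (hS m).symm
  constructor
  · exact PPPoly.exists_translation _ (fun x => (exists_right_of_le hc hS hn x).1)
      (fun y => by
        obtain ⟨x, hx⟩ := (exists_right_of_le hc' hS' hn' y).1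
        exact ⟨x, hx.symm⟩)
      (fun x y x' y' h h' => lt_iff hc.mono hc'.mono h h')
  · exact PPPoly.exists_translation _ (fun x => (exists_right_of_le hc hS hn x).2)
      (fun y => by
        obtain ⟨x, hx⟩ := (exists_right_of_le hc' hS' hn' y).2
        exact ⟨x, hx.symm⟩)
      (fun x y x' y' h h' => lt_iff hc.mono hc'.mono h h')

end Corr

/-- The trees determine the cylinder, up to the number of turns around the cylinder. -/
theorem cylinder_eq (P P' : PPP) {c c' : ℤ → ℤ} {l : ℕ} {k k' e : ℤ}
    (hc : P.Enumerates c l) (hc' : P'.Enumerates c' l)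
    (hk : ∀ m, P.next (c m) = c (m + k)) (hk' : ∀ m, P'.next (c' m) = c' (m + k'))
    (hkk : k' = k + l * e)
    (hT : ∀ q : ℕ, q < l → P.fourTuple (c q) = P'.fourTuple (c' q)) :
    P.width = P'.width ∧ P.height = P'.height ∧
      (∀ i, P'.rightmostCol i = P.rightmostCol i) ∧
      ∀ j, P'.topRow j = P.topRow j + P.height * e := by
  have hS := similar_of_fourTuple_eq P P' hc hc' hk hk' hkk hT
  have hw := P'.width_pos
  obtain ⟨a, hcc, ha⟩ : ∃ a, (∀ m, c' m = c m + a) ∧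
      ∀ n, P.width + P.height + P'.width + P'.height ≤ n → ∀ x y,
      Corr P P' c c' (2 * n) (.col x) (.col y) ↔ y = x + (a - n * e * P'.width) := by
    have key : ∀ n, P.width + P.height + P'.width + P'.height ≤ n → ∃ a,
        (∀ m, c' m = c m + (a + n * e * P'.width)) ∧
        ∀ x y, Corr P P' c c' (2 * n) (.col x) (.col y) ↔ y = x + a := by
      intro n hn
      obtain ⟨⟨a, ha⟩, -⟩ := Corr.exists_translation hc hc' hS (n := n) (by omega) (by omega)
      refine ⟨a, fun m => ?_, ha⟩
      have h1 := (ha (c m) _).2 rfl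
      obtain ⟨m', hm'⟩ := hc'.surj (c m + a) (by
        rw [← (Corr.similar hS h1).pruned_iff]
        exact hc.not_pruned m)
      obtain ⟨x, hx1, hx2⟩ := h1.root
      rw [P.parent_iterate_col, P.next_iterate hk, Vertex.col.injEq] at hx1
      rw [P'.parent_iterate_col, ← hm', P'.next_iterate hk', Vertex.col.injEq] at hx2
      have h2 := hc.mono.injective hx1
      have h3 := hc'.mono.injective hx2
      -- Climbing `2 * n` generations adds `n * k` to the index in `P` and `n * k'` in `P'`. Both
      -- climbs end at the same index, so the starting indices differ by `n * (k - k')`.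
      have h4 : m' = m + l * (-(n * e)) := by
        rw [← h2, hkk] at h3
        linarith
      rw [h4, hc'.period] at hm'
      linarith
    obtain ⟨a₀, ha₀, -⟩ := key _ le_rfl
    refine ⟨_, ha₀, fun n hn => ?_⟩
    obtain ⟨a, ha, ha'⟩ := key n hn
    convert ha' using 5
    have h1 := ha 0
    have h2 := ha₀ 0
    linarith
  set n := P.width + P.height + P'.width + P'.height with hn
  obtain ⟨-, b, hb⟩ := Corr.exists_translation hc hc' hS (n := n) (by omega) (by omega)
  -- `Corr` passes to parents: generation `2 * n + 1` maps to generation `2 * n` here, and `2 * n +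
  -- 2` to `2 * n + 1` in `hTop`. The extra `e * width` between the two column translations becomes
  -- the shift of `topRow`.
  have hR : ∀ i, P'.rightmostCol (i + b) = P.rightmostCol i + (a - n * e * P'.width) := fun i =>
    (ha n le_rfl _ _).1 ((hb i _).2 rfl).1
  have hTop : ∀ j, P'.topRow (j + (a - (n + 1 : ℕ) * e * P'.width)) = P.topRow j + b := fun j =>
    (hb _ _).1 ((ha (n + 1) (by omega) j _).2 rfl).1
  -- Column `0` is marked, so its partner is marked too and is a multiple of `width`.
  obtain ⟨f, hf⟩ : ∃ f, a = P'.width * f := by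
    have h0 := (Corr.similar hS ((ha n le_rfl 0 _).2 rfl)).isMarked_eq
    simp only [GluedPaths.isMarked, GluedPaths.toCylinder, Int.zero_emod, decide_true, zero_add,
      Vertex.col.injEq] at h0
    obtain ⟨f, hf⟩ := Int.dvd_of_emod_eq_zero (of_decide_eq_true h0.symm)
    exact ⟨f + n * e, by rw [mul_add, ← hf]; ring⟩
  have hRb : ∀ i, P'.rightmostCol (i + (b - P'.height * (f - n * e))) = P.rightmostCol i := by
    intro i
    have h1 := hR i
    have h2 := P'.rightmostCol_add (i + (b - P'.height * (f - n * e))) (f - n * e)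
    rw [show i + (b - P'.height * (f - n * e)) + P'.height * (f - n * e) = i + b by ring, h1,
      hf] at h2
    linarith
  have hb0 : b - P'.height * (f - n * e) = 0 := by
    have key : ∀ i, 0 ≤ i + (b - P'.height * (f - n * e)) ↔ 0 ≤ i := fun i => by
      rw [← P'.rightmostCol_nonneg_iff, hRb, P.rightmostCol_nonneg_iff]
    have h1 := key 0
    have h2 := key (-(b - P'.height * (f - n * e)))
    omega
  simp only [hb0, add_zero] at hRb
  have hww : (P.width : ℤ) = P'.width := by
    have h1 := hc.period 0 1
    have h2 := hc'.period 0 1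
    rw [hcc, hcc] at h2
    linarith
  have hhh : (P.height : ℤ) = P'.height := by
    have key : ∀ i, (P.height : ℤ) ≤ i ↔ (P'.height : ℤ) ≤ i := fun i => by
      have h1 := P.rightmostCol_ge_iff i 1
      have h2 := P'.rightmostCol_ge_iff i 1
      rw [hRb, ← hww, h1] at h2
      simpa using h2
    have h1 := key P.height
    have h2 := key P'.height
    omega
  refine ⟨by omega, by omega, hRb, fun j => ?_⟩
  have h1 := hTop j
  have h2 := P'.topRow_add j (f - (n + 1 : ℕ) * e)
  rw [show j + P'.width * (f - (n + 1 : ℕ) * e) = j + (a - (n + 1 : ℕ) * e * P'.width) by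
    rw [hf]; ring, h1] at h2
  push_cast at h2
  rw [hhh]
  linarith

end PPPoly

/-! ### Counting the rows and columns that survive pruning -/

namespace PPPoly

/-- The number of integers `i` with `y ≤ i < y + n` that satisfy `f`. -/
def countFrom (f : ℤ → Bool) : ℤ → ℕ → ℕ
  | _, 0 => 0
  | y, n + 1 => (if f y then 1 else 0) + countFrom f (y + 1) n

theorem countFrom_eq_length (f : ℤ → Bool) (y : ℤ) (n : ℕ) :
    (((List.range n).map (fun i : ℕ => y + (i : ℤ))).filter f).length = countFrom f y n := by
  induction n generalizing y with
  | zero => rfl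
  | succ n ih =>
    have h : (fun i : ℕ => y + (i : ℤ)) ∘ Nat.succ = fun i : ℕ => y + 1 + (i : ℤ) := by
      funext i
      simp only [Function.comp, Nat.succ_eq_add_one]
      push_cast
      ring
    rw [List.range_succ_eq_map, List.map_cons, List.map_map, h, List.filter_cons, countFrom, ← ih]
    by_cases hf : f y <;> simp [hf, add_comm]

/-- `a` and `b` are the indices of the first values of `d` at or after the two ends of the interval.
-/
theorem countFrom_eq_sub {f : ℤ → Bool} {d : ℤ → ℤ} (hd : StrictMono d)
    (hf : ∀ i, f i = true ↔ ∃ m, d m = i) {y : ℤ} {n : ℕ} {a b : ℤ} (ha : d (a - 1) < y)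
    (ha' : y ≤ d a) (hb : d (b - 1) < y + n) (hb' : y + n ≤ d b) :
    (countFrom f y n : ℤ) = b - a := by
  induction n generalizing y a with
  | zero =>
    have h1 := hd.lt_iff_lt.1 (hb.trans_le (by simpa using ha'))
    have h2 := hd.lt_iff_lt.1 (ha.trans_le (by simpa using hb'))
    simp only [countFrom]
    omega
  | succ n ih =>
    rw [countFrom]
    by_cases h : f y
    · obtain ⟨x, rfl⟩ := (hf y).1 h
      have h1 := hd.lt_iff_lt.1 ha
      have h2 := hd.le_iff_le.1 ha'
      obtain rfl : x = a := by omega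
      have h3 := hd (show x < x + 1 by omega)
      have := ih (y := d x + 1) (a := x + 1) (by rw [add_sub_cancel_right]; omega) (by omega)
        (by push_cast at hb; linarith) (by push_cast at hb'; linarith)
      rw [if_pos h]
      push_cast
      omega
    · have hne : y ≠ d a := fun e => h ((hf y).2 ⟨a, e.symm⟩)
      have := ih (y := y + 1) (a := a) (by omega) (by omega)
        (by push_cast at hb; linarith) (by push_cast at hb'; linarith)
      rw [if_neg h]
      push_cast
      omega

theorem rdropWhile_north (p : List Step) {n : ℕ} (hn : p.count Step.east = n + 1) :
    ∃ r, p = p.rdropWhile (fun s => s = Step.north) ++ r ∧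
      (p.rdropWhile (fun s => s = Step.north)).count Step.east = n + 1 ∧
      (p.rdropWhile (fun s => s = Step.north)).count Step.north = offsetOf Step.east p n := by
  induction p using List.reverseRecOn with
  | nil => simp at hn
  | append_singleton p a ih =>
    cases a with
    | east =>
      have hn' : p.count Step.east = n := by simpa [List.count_append] using hn
      refine ⟨[], by simp, by simpa using hn, ?_⟩
      have h1 := offsetOf_append_self Step.east p []
      have h2 := count_north_add_count_east p
      rw [hn'] at h1 h2
      rw [List.rdropWhile_concat_neg _ _ _ (by simp), List.count_append]
      simp only [List.count_singleton, reduceCtorEq, beq_iff_eq, if_false]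
      omega
    | north =>
      have hn' : p.count Step.east = n + 1 := by simpa [List.count_append] using hn
      obtain ⟨r, h1, h2, h3⟩ := ih hn'
      rw [List.rdropWhile_concat_pos _ _ _ (by simp), offsetOf_append _ _ _ _ (by omega)]
      refine ⟨r ++ [Step.north], ?_, h2, h3⟩
      rw [← List.append_assoc, ← h1]

namespace PPP

variable (P : PPP)

/-! ### The trunk -/

theorem countFrom_succ_of_pruned {f : ℤ → Bool} {y : ℤ} (h : f y = false) (n : ℕ) :
    countFrom f y (n + 1) = countFrom f (y + 1) n := by
  simp [countFrom, h]

theorem countFrom_succ_of_not_pruned {f : ℤ → Bool} {y : ℤ} (h : f y = true) (n : ℕ) :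
    countFrom f y (n + 1) = countFrom f (y + 1) n + 1 := by
  simp [countFrom, h, add_comm]

theorem count_prunePath_east (p : List Step) (x y : ℤ) :
    (P.prunePath p x y).count Step.east =
      countFrom (fun j => !P.isPruned (.col j)) x (p.count Step.east) := by
  induction p generalizing x y with
  | nil => rfl
  | cons a p ih =>
    cases a with
    | east =>
      rw [GluedPaths.prunePath, List.count_cons_self, countFrom, ← ih _ y]
      by_cases h : P.isPruned (.col x) <;> simp [h, add_comm]
    | north =>
      rw [GluedPaths.prunePath, List.count_cons_of_ne (by simp), ← ih _ (y + 1)]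
      by_cases h : P.isPruned (.row y) <;> simp [h]

/-- Pruning renumbers: a surviving east step gets as index the number of surviving columns before
it, and as height the number of surviving rows below it. -/
theorem offsetOf_prunePath_east (p : List Step) (x y : ℤ) (q : ℕ) (hq : q < p.count Step.east)
    (hp : P.isPruned (.col (x + q)) = false) :
    offsetOf Step.east (P.prunePath p x y) (countFrom (fun j => !P.isPruned (.col j)) x q) =
      countFrom (fun i => !P.isPruned (.row i)) y (offsetOf Step.east p q) := by
  induction p generalizing x y q with
  | nil => simp at hq
  | cons a p ih =>
    cases a with
    | east =>
      cases q with
      | zero =>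
        rw [Nat.cast_zero, add_zero] at hp
        simp [GluedPaths.prunePath, hp, offsetOf, countFrom]
      | succ q =>
        have := ih (x + 1) y q (by simpa using hq)
          (by rw [← hp]; congr 2; push_cast; ring)
        cases h : P.isPruned (.col x) with
        | true =>
          simp only [GluedPaths.prunePath, h, if_true, offsetOf]
          rw [countFrom_succ_of_pruned (by simp [h])]
          exact this
        | false =>
          simp only [GluedPaths.prunePath, h, Bool.false_eq_true, if_false]
          rw [countFrom_succ_of_not_pruned (by simp [h])]
          simp only [offsetOf, if_true]
          exact this
    | north =>
      have := ih x (y + 1) q (by simpa [List.count_cons] using hq) hp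
      have hoff : offsetOf Step.east (Step.north :: p) q = offsetOf Step.east p q + 1 := by
        cases q <;> simp [offsetOf]
      rw [hoff]
      cases h : P.isPruned (.row y) with
      | true =>
        simp only [GluedPaths.prunePath, h, if_true]
        rw [countFrom_succ_of_pruned (by simp [h])]
        exact this
      | false =>
        simp only [GluedPaths.prunePath, h, Bool.false_eq_true, if_false]
        rw [countFrom_succ_of_not_pruned (by simp [h]), ← this]
        generalize countFrom (fun j => !P.isPruned (.col j)) x q = z
        cases z <;> simp [offsetOf]

theorem offsetOf_prunePath_north (p : List Step) (x y : ℤ) (q : ℕ) (hq : q < p.count Step.north)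
    (hp : P.isPruned (.row (y + q)) = false) :
    offsetOf Step.north (P.prunePath p x y) (countFrom (fun i => !P.isPruned (.row i)) y q) =
      countFrom (fun j => !P.isPruned (.col j)) x (offsetOf Step.north p q) := by
  induction p generalizing x y q with
  | nil => simp at hq
  | cons a p ih =>
    cases a with
    | north =>
      cases q with
      | zero =>
        rw [Nat.cast_zero, add_zero] at hp
        simp [GluedPaths.prunePath, hp, offsetOf, countFrom]
      | succ q =>
        have := ih x (y + 1) q (by simpa using hq)
          (by rw [← hp]; congr 2; push_cast; ring)
        cases h : P.isPruned (.row y) with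
        | true =>
          simp only [GluedPaths.prunePath, h, if_true, offsetOf]
          rw [countFrom_succ_of_pruned (by simp [h])]
          exact this
        | false =>
          simp only [GluedPaths.prunePath, h, Bool.false_eq_true, if_false]
          rw [countFrom_succ_of_not_pruned (by simp [h])]
          simp only [offsetOf, if_true]
          exact this
    | east =>
      have := ih (x + 1) y q (by simpa [List.count_cons] using hq) hp
      have hoff : offsetOf Step.north (Step.east :: p) q = offsetOf Step.north p q + 1 := by
        cases q <;> simp [offsetOf]
      rw [hoff]
      cases h : P.isPruned (.col x) with
      | true =>
        simp only [GluedPaths.prunePath, h, if_true]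
        rw [countFrom_succ_of_pruned (by simp [h])]
        exact this
      | false =>
        simp only [GluedPaths.prunePath, h, Bool.false_eq_true, if_false]
        rw [countFrom_succ_of_not_pruned (by simp [h]), ← this]
        generalize countFrom (fun i => !P.isPruned (.row i)) y q = z
        cases z <;> simp [offsetOf]

/-- The shape of the trunk. -/
theorem trunk_spec : ∃ (c : ℤ → ℤ) (l k : ℕ), P.Enumerates c l ∧
    (∀ m, P.next (c m) = c (m + k)) ∧ P.trunk.width = l ∧ P.trunk.gluing = k ∧
    P.trunk.height = l ∧ (∀ m < l, P.trunk.top m = m + k + 1) ∧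
    ∀ m < l, offsetOf Step.north P.trunk.lower m = m + 1 := by
  obtain ⟨c, hc, hc0⟩ := P.exists_enumerates 0
  set l := (P.trunkColumns 0).length with hl
  obtain ⟨k', hk'⟩ := hc.exists_next_eq
  obtain ⟨k, rfl⟩ : ∃ k : ℕ, k' = k := by
    have h1 : c 0 < P.next (c 0) := P.lt_rightmostCol_topRow (c 0)
    rw [hk'] at h1
    have := hc.mono.lt_iff_lt.1 h1
    exact ⟨k'.toNat, by omega⟩
  have hlpos := hc.pos
  have hh := P.height_pos
  have hhg := P.height_add_gluing
  have hc_mem : ∀ q (h : q < l), 0 ≤ c q ∧ c q < P.width := fun q h => by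
    rw [hc0 q h]
    have := (P.mem_trunkColumns 0 _).1 (List.getElem_mem h)
    omega
  have c0 : 0 ≤ c 0 := (hc_mem 0 hlpos).1
  have cneg : c (-1) < 0 := by
    have h1 := hc.period ((l - 1 : ℕ) : ℤ) (-1)
    have h2 := (hc_mem (l - 1) (by omega)).2
    rw [show ((l - 1 : ℕ) : ℤ) + l * (-1) = -1 by rw [Nat.cast_sub hlpos]; push_cast; ring] at h1
    omega
  have cl : P.width ≤ c l := by
    have h1 := hc.period 0 1
    rw [mul_one, mul_one, zero_add] at h1
    omega
  -- the rows of the trunk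
  obtain ⟨d, hdR, hdT⟩ : ∃ d : ℤ → ℤ, (∀ m, P.rightmostCol (d m) = c m) ∧
      ∀ m, P.topRow (c m) = d (m + k) := by
    refine ⟨fun m => P.topRow (c (m - k)), fun m => ?_, fun m => ?_⟩
    · have := hk' (m - k)
      rwa [sub_add_cancel] at this
    · simp only [add_sub_cancel_right]
  have hdmono : StrictMono d := fun m m' h => by
    refine P.rightmostCol_mono.reflect_lt ?_
    rw [hdR, hdR]
    exact hc.mono h
  have hdnp : ∀ m, ¬ P.Pruned (.row (d m)) := fun m => by
    have := hdT (m - k)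
    rw [sub_add_cancel] at this
    rw [← this]
    exact P.not_pruned_parent (hc.not_pruned _)
  have hfr : ∀ i, (!P.isPruned (.row i)) = true ↔ ∃ m, d m = i := by
    intro i
    rw [Bool.not_eq_true', P.isPruned_eq_false]
    constructor
    · intro hi
      obtain ⟨m, hm⟩ := hc.surj _ (P.not_pruned_parent hi)
      refine ⟨m, Vertex.row.inj (P.eq_of_parent_eq (hdnp m) hi ?_)⟩
      exact congrArg Vertex.col ((hdR m).trans hm)
    · rintro ⟨m, rfl⟩
      exact hdnp m
  have hfc : ∀ j, (!P.isPruned (.col j)) = true ↔ ∃ m, c m = j := by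
    intro j
    rw [Bool.not_eq_true', P.isPruned_eq_false]
    constructor
    · exact hc.surj j
    · rintro ⟨m, rfl⟩
      exact hc.not_pruned m
  have d0 : 0 ≤ d 0 := by rw [← P.rightmostCol_nonneg_iff, hdR]; exact c0
  have dneg : d (-1) < 0 := by
    rw [← not_le, ← P.rightmostCol_nonneg_iff, hdR, not_le]; exact cneg
  have dl : P.height ≤ d l := by
    have := (P.rightmostCol_ge_iff (d l) 1).1 (by rw [hdR]; simpa using cl)
    simpa using this
  have dlt : ∀ q : ℕ, q < l → 0 ≤ d q ∧ d q < P.height := fun q hq => by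
    refine ⟨d0.trans (hdmono.monotone (by omega)), lt_of_not_ge fun h => ?_⟩
    have h1 := (P.rightmostCol_ge_iff (d q) 1).2 (by simpa using h)
    rw [hdR] at h1
    have := (hc_mem q hq).2
    omega
  have countc : ∀ (n : ℕ) (b : ℤ), c (b - 1) < n → n ≤ c b →
      (countFrom (fun j => !P.isPruned (.col j)) 0 n : ℤ) = b := fun n b h1 h2 => by
    have := countFrom_eq_sub hc.mono hfc (y := 0) (n := n) (a := 0) (b := b) (by simpa using cneg)
      c0 (by simpa using h1) (by simpa using h2)
    simpa using this
  have countd : ∀ (n : ℕ) (b : ℤ), d (b - 1) < n → n ≤ d b →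
      (countFrom (fun i => !P.isPruned (.row i)) 0 n : ℤ) = b := fun n b h1 h2 => by
    have := countFrom_eq_sub hdmono hfr (y := 0) (n := n) (a := 0) (b := b) (by simpa using dneg)
      d0 (by simpa using h1) (by simpa using h2)
    simpa using this
  -- the upper path
  have hQ : (P.prunePath P.upper 0 0).count Step.east = (l - 1) + 1 := by
    rw [count_prunePath_east]
    have h2 := (hc_mem (l - 1) (by omega)).2
    have := countc P.width l (by rw [Nat.cast_sub hlpos] at h2; exact_mod_cast h2) cl
    change countFrom _ 0 P.width = _
    omega
  have hQoff : ∀ m < l, offsetOf Step.east (P.prunePath P.upper 0 0) m = m + k + 1 := by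
    intro m hm
    obtain ⟨h1, h2⟩ := hc_mem m hm
    obtain ⟨q, hq⟩ := Int.eq_ofNat_of_zero_le h1
    have hqw : q < P.width := by omega
    have h3 := P.offsetOf_prunePath_east P.upper 0 0 q hqw
      (by rw [zero_add, ← hq, P.isPruned_eq_false]; exact hc.not_pruned m)
    have h4 := countc q m (by rw [← hq]; exact hc.mono (by omega)) (by omega)
    have h5 : ((P.top q : ℕ) : ℤ) = d (m + k) + 1 := by
      have := P.topRow_natCast q hqw
      rw [← hq, hdT] at this
      omega
    have h6 := countd (P.top q) (m + k + 1) (by rw [h5, add_sub_cancel_right]; omega)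
      (by rw [h5]; exact hdmono (show (m + k : ℤ) < m + k + 1 by omega))
    rw [show countFrom (fun j => !P.isPruned (.col j)) 0 q = m by omega] at h3
    rw [h3]
    change countFrom _ 0 (P.top q) = _
    omega
  obtain ⟨r, hr, hr1, hr2⟩ := rdropWhile_north _ hQ
  change (P.trunkUpper).count Step.east = _ at hr1
  change (P.trunkUpper).count Step.north = _ at hr2
  change _ = P.trunkUpper ++ r at hr
  rw [hQoff _ (by omega)] at hr2
  have hlen := count_north_add_count_east P.trunkUpper
  have htH : P.trunkHeight = l := by
    have h1 : P.trunkHeight = countFrom (fun i => !P.isPruned (.row i)) 0 P.height := by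
      rw [← countFrom_eq_length]
      simp only [GluedPaths.trunkHeight, do_cast_eq_map, zero_add]
    have h2 := (dlt (l - 1) (by omega)).2
    have := countd P.height l (by rw [Nat.cast_sub hlpos] at h2; exact_mod_cast h2) dl
    omega
  have hg : P.trunk.gluing = k := by
    change P.trunkUpper.count Step.north - P.trunkHeight = k
    omega
  refine ⟨c, l, k, hc, hk', ?_, hg, ?_, fun m hm => ?_, fun m hm => ?_⟩
  · change P.trunkUpper.count Step.east = l
    omega
  · change P.trunkUpper.count Step.north - P.trunk.gluing = l
    omega
  · change offsetOf Step.east P.trunkUpper m = _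
    rw [← hQoff m hm, hr, offsetOf_append _ _ _ _ (by omega)]
  · obtain ⟨h1, h2⟩ := dlt m hm
    obtain ⟨q, hq⟩ := Int.eq_ofNat_of_zero_le h1
    have h3 := P.offsetOf_prunePath_north P.lower 0 0 q (by rw [P.count_lower_north]; omega)
      (by rw [zero_add, ← hq, P.isPruned_eq_false]; exact hdnp m)
    have h4 := countd q m (by rw [← hq]; exact hdmono (by omega)) (by omega)
    have h5 : ((offsetOf Step.north P.lower q : ℕ) : ℤ) = c m + 1 := by
      have := P.rightmostCol_natCast q (by omega)
      rw [← hq, hdR] at this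
      omega
    have h6 := countc (offsetOf Step.north P.lower q) (m + 1)
      (by rw [h5, add_sub_cancel_right]; omega)
      (by rw [h5]; exact hc.mono (show (m : ℤ) < m + 1 by omega))
    rw [show countFrom (fun i => !P.isPruned (.row i)) 0 q = m by omega] at h3
    have h7 : offsetOf Step.north (P.prunePath P.lower 0 0) m = m + 1 := by
      rw [h3]
      omega
    change offsetOf Step.north ((P.prunePath P.lower 0 0).take P.trunkUpper.length) m = _
    -- The truncation is harmless: the north step in question has index `2 * m + 1`, and the upper
    -- path of the trunk has length `2 * l + k`.
    rw [offsetOf_take _ _ _ _ (by omega), h7]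

/-- The number of columns of the trunk, and its gluing size in terms of the map to the parent of
the parent. -/
theorem Enumerates.trunk_eq {P : PPP} {c : ℤ → ℤ} {l : ℕ} (h : P.Enumerates c l) :
    P.trunk.width = l ∧ ∀ m, P.next (c m) = c (m + P.intrinsicThickness) := by
  obtain ⟨c₀, l₀, k, h₀, hk, hw, hg, -⟩ := P.trunk_spec
  obtain ⟨hl, a, ha⟩ := h.exists_eq_add h₀
  refine ⟨hw.trans hl.symm, fun m => ?_⟩
  rw [← ha, hk, ← ha, show P.intrinsicThickness = k from hg]
  congr 1
  ring

/-- On the trunk `topRow j = j + k` and `rightmostCol i = i`, so the cyclic structure depends only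
on `l` and on `k` modulo `l`. -/
theorem cyclicStructure_eq_range : P.cyclicStructure = Set.range fun v : Vertex => match v with
    | .col j => (Vertex.col (j % P.trunk.width),
        Vertex.row ((j + P.intrinsicThickness) % P.trunk.width))
    | .row i => (Vertex.row (i % P.trunk.width), Vertex.col (i % P.trunk.width)) := by
  obtain ⟨c, l, k, hc, -, hw, hg, hh, htop, hlow⟩ := P.trunk_spec
  have hlpos := hc.pos
  have hg' : P.intrinsicThickness = k := hg
  have hmod : ∀ j : ℤ, (j % l).toNat < l ∧ ((j % l).toNat : ℤ) = j % l := fun j => by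
    have h1 := Int.emod_lt_of_pos j (by omega : (0 : ℤ) < l)
    have h2 := Int.emod_nonneg j (by omega : (l : ℤ) ≠ 0)
    omega
  unfold GluedPaths.cyclicStructure
  congr 1
  funext v
  cases v with
  | col j =>
    have : P.trunk.topRow j = j + k := by
      unfold GluedPaths.topRow
      rw [hw, hh, htop _ (hmod j).1]
      have := Int.emod_add_mul_ediv j l
      push_cast
      rw [(hmod j).2]
      linarith
    simp only [GluedPaths.toCylinder, GluedPaths.parent, this, hw, hh, hg']
  | row i =>
    have : P.trunk.rightmostCol i = i := by
      unfold GluedPaths.rightmostCol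
      rw [hw, hh, hlow _ (hmod i).1]
      have := Int.emod_add_mul_ediv i l
      push_cast
      rw [(hmod i).2]
      linarith
    simp only [GluedPaths.toCylinder, GluedPaths.parent, this, hw, hh]

end PPP

end PPPoly

namespace PPPoly

namespace PPP

variable (P : PPP)

/-! ### The boundary paths on the cylinder -/

theorem length_upperPath : P.upperPath.length = P.width + P.height := by
  have h1 := P.count_upper
  have h2 := P.height_add_gluing
  rw [GluedPaths.upperPath, List.length_drop]
  omega

theorem gluing_le_offset : P.gluing ≤ offsetOf Step.east P.upper 0 := P.gluing_le_top 0

theorem count_upperPath : P.upperPath.count Step.east = P.width :=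
  (offsetOf_drop Step.east P.upper P.gluing P.gluing_le_offset).2

theorem offsetOf_upperPath (n : ℕ) (hn : n < P.width) :
    (offsetOf Step.east P.upperPath n : ℤ) = P.topRow n - P.topRow (-1) := by
  have h1 := (offsetOf_drop Step.east P.upper P.gluing P.gluing_le_offset).1 n
  rw [P.topRow_natCast n hn, P.topRow_neg_one]
  unfold GluedPaths.top GluedPaths.upperPath
  omega

/-- All east steps of the lower path come before its last `gluing` steps, so truncating it loses no
information about the bottoms of the columns. -/
theorem add_bot_lt (j : ℕ) (hj : j < P.width) : j + P.bot j < P.width + P.height := by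
  have h1 := P.gluing_le_last
  have h2 := P.top_last
  have h3 := P.height_add_gluing
  have h4 : P.bot j ≤ P.bot (P.width - 1) := offsetOf_mono _ _ (by omega)
  omega

theorem lowerPath_eq : P.lowerPath = P.lower.take (P.width + P.height) := by
  have h1 := P.count_upper
  have h2 := P.height_add_gluing
  have h3 := P.polyomino.length_eq
  rw [GluedPaths.lowerPath]
  congr 1
  omega

theorem length_lowerPath : P.lowerPath.length = P.width + P.height := by
  have h1 := P.count_upper
  have h2 := P.height_add_gluing
  have h3 := P.polyomino.length_eq
  rw [lowerPath_eq, List.length_take]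
  omega

theorem count_lowerPath : P.lowerPath.count Step.north = P.height := by
  have h1 := count_north_add_count_east P.lowerPath
  have hw := P.width_pos
  have h2 := lt_count_take_iff Step.east P.lower (P.width - 1) (P.width + P.height)
    (by rw [P.count_lower_east]; omega)
  have h3 := h2.2 (P.add_bot_lt _ (by omega))
  have h4 : P.lowerPath.count Step.east ≤ P.width := by
    rw [← P.count_lower_east]
    exact (List.take_sublist _ _).count_le _
  rw [← lowerPath_eq] at h3
  rw [length_lowerPath] at h1
  omega

theorem offsetOf_lowerPath (n : ℕ) (hn : n < P.height) :
    (offsetOf Step.north P.lowerPath n : ℤ) = P.rightmostCol n + 1 := by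
  have := P.lower_offset_le n
  rw [P.rightmostCol_natCast n hn, lowerPath_eq, offsetOf_take _ _ _ _ (by omega)]
  ring

theorem bot_eq_offsetOf_lowerPath (j : ℕ) (hj : j < P.width) :
    P.bot j = offsetOf Step.east P.lowerPath j := by
  rw [lowerPath_eq, offsetOf_take _ _ _ _ (P.add_bot_lt j hj)]
  rfl

theorem bot_le_top (j : ℕ) (hj : j < P.width) : P.bot j ≤ P.top j := by
  by_contra hcon
  have h1 := P.count_upper
  have h2 := P.top_le j
  have h3 := P.polyomino.length_eq
  have hu := lt_count_take_iff Step.east P.upper j (j + P.top j + 1) hj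
  have hl := lt_count_take_iff Step.east P.lower j (j + P.top j + 1)
    (by rw [P.count_lower_east]; exact hj)
  have hu' := hu.2 (by unfold GluedPaths.top; omega)
  have hl' := hl.not.2 (by unfold GluedPaths.bot at hcon; omega)
  have h4 := count_north_add_count_east (P.upper.take (j + P.top j + 1))
  have h5 := count_north_add_count_east (P.lower.take (j + P.top j + 1))
  rw [List.length_take] at h4 h5
  rcases Nat.lt_or_ge (j + P.top j + 1) P.upper.length with h | h
  · have := P.count_take_lower_lt _ (by omega) h
    omega
  · rw [List.take_of_length_le (by omega), P.count_lower_east] at hl'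
    omega

theorem area_eq : (P.area : ℤ) = ∑ j ∈ Finset.range P.width, (P.topRow j + 1 - P.bot j) := by
  rw [GluedPaths.area, Nat.cast_sum]
  refine Finset.sum_congr rfl fun j hj => ?_
  rw [Finset.mem_range] at hj
  rw [Nat.cast_sub (P.bot_le_top j hj), P.topRow_natCast j hj]
  ring

theorem treeList_eq : P.treeList = (P.trunkColumns P.startCol).map P.fourTuple := by
  simp only [GluedPaths.treeList, trunkColumns, do_cast_eq_map, List.map_map]
  rfl

end PPP

/-- Equal trees and intrinsic thicknesses that differ by `e` times the width of the trunk. -/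
theorem conclusion_of_treeList_eq (P₁ P₂ : PPP) (hlist : P₁.treeList = P₂.treeList) {e : ℤ}
    (he : |e| = 1)
    (hthickness : (P₂.intrinsicThickness : ℤ) = P₁.intrinsicThickness + P₁.trunk.width * e) :
    (P₁.upperPath = P₂.upperPath ∧ P₁.lowerPath = P₂.lowerPath ∧
      P₁.cyclicStructure = P₂.cyclicStructure) ∧
    (P₁.width = P₂.width ∧ P₁.height = P₂.height ∧
      |(P₁.area : ℤ) - (P₂.area : ℤ)| = (P₁.width : ℤ) * (P₁.height : ℤ)) := by
  obtain ⟨c₁, hc₁, hq₁⟩ := P₁.exists_enumerates P₁.startCol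
  obtain ⟨c₂, hc₂, hq₂⟩ := P₂.exists_enumerates P₂.startCol
  rw [P₁.treeList_eq, P₂.treeList_eq] at hlist
  have hlen : (P₁.trunkColumns P₁.startCol).length = (P₂.trunkColumns P₂.startCol).length := by
    simpa using congrArg List.length hlist
  obtain ⟨hw₁, hk₁⟩ := hc₁.trunk_eq
  obtain ⟨hw₂, hk₂⟩ := hc₂.trunk_eq
  have hT : ∀ q : ℕ, q < (P₁.trunkColumns P₁.startCol).length →
      P₁.fourTuple (c₁ q) = P₂.fourTuple (c₂ q) := by
    intro q hq
    rw [hq₁ q hq, hq₂ q (by omega)]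
    have := congrArg (·[q]?) hlist
    simpa [List.getElem?_eq_getElem hq, List.getElem?_eq_getElem (hlen ▸ hq)] using this
  rw [hw₁] at hthickness
  obtain ⟨hw, hh, hR, hTop⟩ := cylinder_eq P₁ P₂ hc₁ (hlen ▸ hc₂) hk₁ hk₂ hthickness hT
  have hlow : P₁.lowerPath = P₂.lowerPath := by
    refine path_ext Step.north _ _ (by rw [P₁.length_lowerPath, P₂.length_lowerPath, hw, hh])
      (by rw [P₁.count_lowerPath, P₂.count_lowerPath, hh]) fun n hn => ?_
    rw [P₁.count_lowerPath] at hn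
    have h1 := P₁.offsetOf_lowerPath n hn
    have h2 := P₂.offsetOf_lowerPath n (by omega)
    rw [hR] at h2
    omega
  refine ⟨⟨?_, hlow, ?_⟩, hw, hh, ?_⟩
  · refine path_ext Step.east _ _ (by rw [P₁.length_upperPath, P₂.length_upperPath, hw, hh])
      (by rw [P₁.count_upperPath, P₂.count_upperPath, hw]) fun n hn => ?_
    rw [P₁.count_upperPath] at hn
    have h1 := P₁.offsetOf_upperPath n hn
    have h2 := P₂.offsetOf_upperPath n (by omega)
    -- The constant `height * e` cancels in the difference of `topRow n` and `topRow (-1)`.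
    rw [hTop, hTop] at h2
    omega
  · have hww : P₁.trunk.width = P₂.trunk.width := by omega
    have hmod : ∀ j : ℤ, (j + P₂.intrinsicThickness) % (P₂.trunk.width : ℤ) =
        (j + P₁.intrinsicThickness) % (P₂.trunk.width : ℤ) := fun j => by
      rw [hthickness, ← hw₁, hww, ← add_assoc, Int.add_mul_emod_self_left]
    rw [P₁.cyclicStructure_eq_range, P₂.cyclicStructure_eq_range, hww]
    simp only [hmod]
  · have h : (P₁.area : ℤ) - P₂.area = P₁.width * P₁.height * (-e) := by
      rw [P₁.area_eq, P₂.area_eq, ← hw, ← Finset.sum_sub_distrib]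
      -- The bottoms agree because the lower paths do, so only the shift of `topRow` remains in each
      -- column.
      rw [Finset.sum_congr rfl (g := fun _ => P₁.height * (-e)) fun j hj => ?_]
      · simp [mul_assoc]
      · rw [Finset.mem_range] at hj
        rw [P₁.bot_eq_offsetOf_lowerPath j hj, P₂.bot_eq_offsetOf_lowerPath j (by omega), hlow,
          hTop]
        ring
    rw [h, abs_mul, abs_neg, he, mul_one, abs_of_nonneg (by positivity)]

end PPPoly

theorem mainTheorem2 (P₁ P₂ : PPPoly.PPP)
    (hlist : (PPPoly.psi P₁).2 = (PPPoly.psi P₂).2)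
    (hthickness : |((PPPoly.psi P₁).1 : ℤ) - ((PPPoly.psi P₂).1 : ℤ)| = (P₁.trunk.width : ℤ)) :
    (P₁.upperPath = P₂.upperPath ∧ P₁.lowerPath = P₂.lowerPath ∧
      P₁.cyclicStructure = P₂.cyclicStructure) ∧
    (P₁.width = P₂.width ∧ P₁.height = P₂.height ∧
      |(P₁.area : ℤ) - (P₂.area : ℤ)| = (P₁.width : ℤ) * (P₁.height : ℤ)) := by
  change |(P₁.intrinsicThickness : ℤ) - (P₂.intrinsicThickness : ℤ)| = _ at hthickness
  rcases abs_eq (Nat.cast_nonneg _) |>.1 hthickness with h | h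
  · exact PPPoly.conclusion_of_treeList_eq P₁ P₂ hlist (e := -1) (by simp) (by linarith)
  · exact PPPoly.conclusion_of_treeList_eq P₁ P₂ hlist (e := 1) (by simp) (by linarith)
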